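/- Let $p$ be a prime and let $\mathbb{Q}_p^{\mathrm{nr}}$ be the maximal unramified extension of $\mathbb{Q}_p$, i.e. the compositum of all finite unramified extensions of $\mathbb{Q}_p$ inside a fixed algebraic closure. Let $$C(X,Y,Z)=aX^3+bX^2Y+cX^2Z+dXY^2+eXYZ+fXZ^2+gY^3+hY^2Z+iYZ^2+jZ^3$$ be a random ternary cubic form over $\mathbb{Z}_p$, meaning that its coefficients $a,\dots,j$ are independent and each is distributed according to the normalized additive Haar measure on $\mathbb{Z}_p$. Then the event that the plane cubic curve $C=0$ has a $\mathbb{Q}_p^{\mathrm{nr}}$-rational point, i.e. that there is $(x,y,z)\in(\mathbb{Q}_p^{\mathrm{nr}})^3\setminus\{(0,0,0)\}$ with $C(x,y,z)=0$, is measurable (for the completed measure), and its probability is $$\rho^{\mathrm{nr}}(p)=1-\frac{p^{11}(p-1)(p^2-1)(p^3-1)}{(p^8-1)(p^9-1)(p^{10}-1)}.$$ -/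

import Mathlib

open MeasureTheory

noncomputable section

namespace PlaneCubic

/-! ### Ternary cubic forms -/

/-- The ternary cubic form
`aX³+bX²Y+cX²Z+dXY²+eXYZ+fXZ²+gY³+hY²Z+iYZ²+jZ³` with coefficient vector
`(a, b, c, d, e, f, g, h, i, j)`. The variables `X, Y, Z` are `X 0, X 1, X 2`. -/
def cubicForm {R : Type*} [CommRing R] (c : Fin 10 → R) : MvPolynomial (Fin 3) R :=
  let X : MvPolynomial (Fin 3) R := MvPolynomial.X 0
  let Y : MvPolynomial (Fin 3) R := MvPolynomial.X 1
  let Z : MvPolynomial (Fin 3) R := MvPolynomial.X 2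
  let k : Fin 10 → MvPolynomial (Fin 3) R := fun n => MvPolynomial.C (c n)
  k 0 * X ^ 3 + k 1 * X ^ 2 * Y + k 2 * X ^ 2 * Z + k 3 * X * Y ^ 2 + k 4 * X * Y * Z
    + k 5 * X * Z ^ 2 + k 6 * Y ^ 3 + k 7 * Y ^ 2 * Z + k 8 * Y * Z ^ 2 + k 9 * Z ^ 3

/-- The plane cubic curve `C = 0` attached to the coefficient vector `c` has a `K`-rational
point: the form has a zero `(x, y, z) ≠ (0, 0, 0)` with coordinates in `K`. -/
def HasPoint {R : Type*} [CommRing R] (c : Fin 10 → R) (K : Type*) [Field K] [Algebra R K] :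
    Prop :=
  ∃ v : Fin 3 → K, v ≠ 0 ∧ MvPolynomial.aeval v (cubicForm c) = 0

/-! ### The maximal unramified extension of `ℚ_p` -/

/-- A subextension `K` of a fixed algebraic closure of `ℚ_p` is finite and unramified over `ℚ_p`:
it has finite degree and its ring of integers (the integral closure of `ℤ_p` in `K`) is
unramified over `ℤ_p`. -/
def IsFiniteUnramified (p : ℕ) [Fact p.Prime] (K : IntermediateField ℚ_[p] (PadicAlgCl p)) :
    Prop :=
  FiniteDimensional ℚ_[p] K ∧ Algebra.FormallyUnramified ℤ_[p] (integralClosure ℤ_[p] K)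

/-- The maximal unramified extension `ℚ_p^nr` of `ℚ_p`: the compositum, in a fixed algebraic
closure, of all finite unramified extensions of `ℚ_p`. -/
def maxUnramified (p : ℕ) [Fact p.Prime] : IntermediateField ℚ_[p] (PadicAlgCl p) :=
  ⨆ (K : IntermediateField ℚ_[p] (PadicAlgCl p)) (_ : IsFiniteUnramified p K), K

/-! ### Random ternary cubic forms over `ℤ_p` -/

/-- `ℤ_p` carries its Borel σ-algebra. -/
instance instMeasurableSpacePadicInt (p : ℕ) [Fact p.Prime] : MeasurableSpace ℤ_[p] :=
  borel ℤ_[p]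

instance instBorelSpacePadicInt (p : ℕ) [Fact p.Prime] : BorelSpace ℤ_[p] := ⟨rfl⟩

/-- The additive Haar measure on `ℤ_p`, normalised to have total mass `1`. -/
def padicMeasure (p : ℕ) [Fact p.Prime] : Measure ℤ_[p] :=
  Measure.addHaarMeasure ⊤

instance instIsProbabilityMeasurePadicMeasure (p : ℕ) [Fact p.Prime] :
    IsProbabilityMeasure (padicMeasure p) := by
  refine ⟨?_⟩
  simpa [padicMeasure] using
    Measure.addHaarMeasure_self (K₀ := (⊤ : TopologicalSpace.PositiveCompacts ℤ_[p]))

/-- The law of a random ternary cubic form over `ℤ_p`: its ten coefficients are independent and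
each is distributed according to the normalised Haar measure. -/
def cubicMeasure (p : ℕ) [Fact p.Prime] : Measure (Fin 10 → ℤ_[p]) :=
  Measure.pi fun _ => padicMeasure p

end PlaneCubic

end

/-!
Let `q = p⁻¹`. The proof computes the measure of the *insoluble* forms, those with no zero over
`ℚ_p^nr`.

*Reduction modulo `p`.* Over an algebraic closure of `𝔽_p` a nonzero ternary cubic form has a
smooth zero unless it is a multiple of the cube of a linear form, and then the line is defined over
`𝔽_p` (`exists_smooth_zero_or_isTripleLine`). A smooth zero lies over a finite field, the residue
field of a finite unramified extension of `ℤ_p` (`exists_unramified_lift`), and lifts by Hensel's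
lemma in the form `exists_root_cubic`. So an insoluble form reduces to zero or to one of the
`p² + p + 1` triple lines (`hasPoint_of_reduction`).

*Minimalisation.* The coefficientwise divisibility conditions on a form cut out boxes, and the
measure of the insoluble forms of a box is multiplied by a known power of `q` under `c ↦ p c` and
under the substitutions `X ↦ p X`, `Y ↦ p Y`. Alternating these with the count of the possible
reductions leads from the forms reducing to a triple line either back to forms of the same kind or
to the *critical* forms, in which the coefficients of `X³`, `Y³`, `Z³` have valuations exactly
`0`, `1`, `2` and the other monomials are dominated by these three. Critical forms are insoluble,
because valuations on `ℚ_p^nr` are integers, so that the three dominant terms have distinct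
valuations modulo `3` (`not_hasPoint_of_isCritical`); they fill a box of measure
`q¹³ (1 - q)³`. The resulting linear equations are `vol_zero_empty`, `vol_line`, `vol_line_point`
and `vol_line_point_of_dvd`, and they determine the measure (`measure_eq`).

*Measurability.* The recursion uses only a few properties of the set of insoluble forms, collected
in `IsInsolubleLocus`, and no measurability. The smallest set of forms over `ℚ_p` that contains the
critical ones and is stable under changes of variables and scalars (`Saturated`) is open and
consists of insoluble forms; its integral forms have the same properties, hence the same measure.
An open subset of the insoluble set of the same measure makes the latter null-measurable.
-/

noncomputable section

namespace PlaneCubic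

/-! ### Ternary cubics that are a multiple of a cube -/

/-- The value at `(x, y, z)` of the ternary cubic form with coefficient vector `c`. -/
def cubicEval {R : Type*} [CommRing R] (c : Fin 10 → R) (x y z : R) : R :=
  c 0 * x ^ 3 + c 1 * x ^ 2 * y + c 2 * x ^ 2 * z + c 3 * x * y ^ 2 + c 4 * x * y * z
    + c 5 * x * z ^ 2 + c 6 * y ^ 3 + c 7 * y ^ 2 * z + c 8 * y * z ^ 2 + c 9 * z ^ 3

/-- The value at `(x, y, z)` of the partial derivative `∂/∂X` of the cubic form `c`. -/
def cubicDX {R : Type*} [CommRing R] (c : Fin 10 → R) (x y z : R) : R :=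
  3 * c 0 * x ^ 2 + 2 * c 1 * x * y + 2 * c 2 * x * z + c 3 * y ^ 2 + c 4 * y * z + c 5 * z ^ 2

/-- The value at `(x, y, z)` of the partial derivative `∂/∂Y` of the cubic form `c`. -/
def cubicDY {R : Type*} [CommRing R] (c : Fin 10 → R) (x y z : R) : R :=
  c 1 * x ^ 2 + 2 * c 3 * x * y + c 4 * x * z + 3 * c 6 * y ^ 2 + 2 * c 7 * y * z + c 8 * z ^ 2

/-- The value at `(x, y, z)` of the partial derivative `∂/∂Z` of the cubic form `c`. -/
def cubicDZ {R : Type*} [CommRing R] (c : Fin 10 → R) (x y z : R) : R :=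
  c 2 * x ^ 2 + c 4 * x * y + 2 * c 5 * x * z + c 7 * y ^ 2 + 2 * c 8 * y * z + 3 * c 9 * z ^ 2

/-- The coefficient vector of `a(lX + mY + nZ)³`. -/
def cubeCoeff {R : Type*} [CommRing R] (a l m n : R) : Fin 10 → R :=
  ![a * l ^ 3, 3 * a * l ^ 2 * m, 3 * a * l ^ 2 * n, 3 * a * l * m ^ 2, 6 * a * l * m * n,
    3 * a * l * n ^ 2, a * m ^ 3, 3 * a * m ^ 2 * n, 3 * a * m * n ^ 2, a * n ^ 3]

lemma funext_fin10 {R : Type*} {c d : Fin 10 → R} (h0 : c 0 = d 0) (h1 : c 1 = d 1)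
    (h2 : c 2 = d 2) (h3 : c 3 = d 3) (h4 : c 4 = d 4) (h5 : c 5 = d 5) (h6 : c 6 = d 6)
    (h7 : c 7 = d 7) (h8 : c 8 = d 8) (h9 : c 9 = d 9) : c = d := by
  funext i
  fin_cases i <;> assumption

lemma aeval_cubicForm {R K : Type*} [CommRing R] [Field K] [Algebra R K] (c : Fin 10 → R)
    (v : Fin 3 → K) :
    MvPolynomial.aeval v (cubicForm c)
      = cubicEval (fun i => algebraMap R K (c i)) (v 0) (v 1) (v 2) := by
  simp [cubicForm, cubicEval]

lemma hasPoint_iff {R K : Type*} [CommRing R] [Field K] [Algebra R K] (c : Fin 10 → R) :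
    HasPoint c K ↔ ∃ x y z : K, (x ≠ 0 ∨ y ≠ 0 ∨ z ≠ 0) ∧
      cubicEval (fun i => algebraMap R K (c i)) x y z = 0 := by
  constructor
  · rintro ⟨v, hv, h⟩
    refine ⟨v 0, v 1, v 2, ?_, by rwa [aeval_cubicForm] at h⟩
    by_contra! hc
    exact hv (by funext i; fin_cases i <;> simp [hc])
  · rintro ⟨x, y, z, hv, h⟩
    refine ⟨![x, y, z], ?_, by rw [aeval_cubicForm]; exact h⟩
    intro hc
    have h0 := congrFun hc 0
    have h1 := congrFun hc 1
    have h2 := congrFun hc 2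
    simp at h0 h1 h2
    simp_all

lemma map_cubicEval {R S : Type*} [CommRing R] [CommRing S] (f : R →+* S) (c : Fin 10 → R)
    (x y z : R) : f (cubicEval c x y z) = cubicEval (fun i => f (c i)) (f x) (f y) (f z) := by
  simp [cubicEval]

lemma map_cubicDX {R S : Type*} [CommRing R] [CommRing S] (f : R →+* S) (c : Fin 10 → R)
    (x y z : R) : f (cubicDX c x y z) = cubicDX (fun i => f (c i)) (f x) (f y) (f z) := by
  simp [cubicDX, map_ofNat]

lemma map_cubicDY {R S : Type*} [CommRing R] [CommRing S] (f : R →+* S) (c : Fin 10 → R)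
    (x y z : R) : f (cubicDY c x y z) = cubicDY (fun i => f (c i)) (f x) (f y) (f z) := by
  simp [cubicDY, map_ofNat]

lemma map_cubicDZ {R S : Type*} [CommRing R] [CommRing S] (f : R →+* S) (c : Fin 10 → R)
    (x y z : R) : f (cubicDZ c x y z) = cubicDZ (fun i => f (c i)) (f x) (f y) (f z) := by
  simp [cubicDZ, map_ofNat]

/-- A binary cubic `bX²Y + dXY²` vanishing at `(1, 1)` and `(ω, 1)` is zero. -/
lemma eq_zero_of_binary {k : Type*} [Field k] {ω b d : k} (h0 : ω ≠ 0) (h1 : ω ≠ 1)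
    (e1 : b + d = 0) (e2 : b * ω ^ 2 + d * ω = 0) : b = 0 ∧ d = 0 := by
  have hd : d = -b := by linear_combination e1
  subst hd
  have : b * (ω * (ω - 1)) = 0 := by linear_combination e2
  have hb : b = 0 := by
    rcases mul_eq_zero.1 this with h | h
    · exact h
    · exact absurd h (mul_ne_zero h0 (sub_ne_zero.2 h1))
  simp [hb]

lemma exists_ne_zero_ne_one (k : Type*) [Field k] [Infinite k] : ∃ ω : k, ω ≠ 0 ∧ ω ≠ 1 := by
  classical
  obtain ⟨ω, h⟩ := Infinite.exists_notMem_finset ({0, 1} : Finset k)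
  exact ⟨ω, by simpa using h⟩

lemma eq_zero_of_cubicEval_eq_zero {k : Type*} [Field k] [Infinite k] {c : Fin 10 → k}
    (h : ∀ x y z, cubicEval c x y z = 0) : c = 0 := by
  obtain ⟨ω, hω0, hω1⟩ := exists_ne_zero_ne_one k
  have h0 : c 0 = 0 := by simpa [cubicEval] using h 1 0 0
  have h6 : c 6 = 0 := by simpa [cubicEval] using h 0 1 0
  have h9 : c 9 = 0 := by simpa [cubicEval] using h 0 0 1
  obtain ⟨h1, h3⟩ := eq_zero_of_binary hω0 hω1
    (by simpa [cubicEval, h0, h6, h9] using h 1 1 0)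
    (by simpa [cubicEval, h0, h6, h9] using h ω 1 0)
  obtain ⟨h2, h5⟩ := eq_zero_of_binary hω0 hω1
    (by simpa [cubicEval, h0, h6, h9] using h 1 0 1)
    (by simpa [cubicEval, h0, h6, h9] using h ω 0 1)
  obtain ⟨h7, h8⟩ := eq_zero_of_binary hω0 hω1
    (by simpa [cubicEval, h0, h6, h9] using h 0 1 1)
    (by simpa [cubicEval, h0, h6, h9] using h 0 ω 1)
  have h4 : c 4 = 0 := by
    simpa [cubicEval, h0, h1, h2, h3, h5, h6, h7, h8, h9] using h 1 1 1
  exact funext_fin10 h0 h1 h2 h3 h4 h5 h6 h7 h8 h9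

lemma cubic_eq_cube_of_roots_multiple {k : Type*} [Field k] [IsAlgClosed k] {A B C D : k}
    (hA : A ≠ 0)
    (h : ∀ t, A * t ^ 3 + B * t ^ 2 + C * t + D = 0 → 3 * A * t ^ 2 + 2 * B * t + C = 0) :
    ∃ t, B = 3 * A * t ∧ C = 3 * A * t ^ 2 ∧ D = A * t ^ 3 := by
  let P : Cubic k := ⟨A, B, C, D⟩
  have hs : (P.toPoly.map (RingHom.id k)).Splits := by
    exact IsAlgClosed.splits _
  obtain ⟨x, y, z, hr⟩ := (Cubic.splits_iff_roots_eq_three (φ := RingHom.id k) (P := P) hA).1 hs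
  have hb := Cubic.b_eq_three_roots (φ := RingHom.id k) (P := P) hA hr
  have hc := Cubic.c_eq_three_roots (φ := RingHom.id k) (P := P) hA hr
  have hd := Cubic.d_eq_three_roots (φ := RingHom.id k) (P := P) hA hr
  simp only [RingHom.id_apply, P] at hb hc hd
  have key : ∀ t u w : k, B = A * -(t + u + w) → C = A * (t * u + t * w + u * w) →
      D = A * -(t * u * w) → (t - u) * (t - w) = 0 := by
    intro t u w h1 h2 h3
    have := h t (by rw [h1, h2, h3]; ring)
    have h4 : A * ((t - u) * (t - w)) = 0 := by
      rw [h1, h2] at this; linear_combination this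
    exact (mul_eq_zero.1 h4).resolve_left hA
  have k1 := key x y z hb hc hd
  have k2 := key y x z (by rw [hb]; ring) (by rw [hc]; ring) (by rw [hd]; ring)
  have k3 := key z x y (by rw [hb]; ring) (by rw [hc]; ring) (by rw [hd]; ring)
  have hxy : x = y ∧ x = z := by
    simp only [mul_eq_zero, sub_eq_zero] at k1 k2 k3
    grind
  obtain ⟨rfl, rfl⟩ := hxy
  exact ⟨-x, by rw [hb]; ring, by rw [hc]; ring, by rw [hd]; ring⟩

/-- Restriction of a cubic form to the line through `P` and `Q`: if all zeros of `c` are singular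
and `c` does not vanish at `P`, then `T ↦ c(TP + Q)` is a cube, because all its roots are
multiple. -/
lemma restrict_eq_cube {k : Type*} [Field k] [IsAlgClosed k] {c : Fin 10 → k}
    (hs : ∀ x y z, cubicEval c x y z = 0 →
      cubicDX c x y z = 0 ∧ cubicDY c x y z = 0 ∧ cubicDZ c x y z = 0)
    {p q r : k} (hP : cubicEval c p q r ≠ 0) (x y z : k) :
    ∃ t, x * cubicDX c p q r + y * cubicDY c p q r + z * cubicDZ c p q r
        = 3 * cubicEval c p q r * t ∧ cubicEval c x y z = cubicEval c p q r * t ^ 3 := by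
  obtain ⟨t, h1, -, h3⟩ := cubic_eq_cube_of_roots_multiple (A := cubicEval c p q r)
    (B := x * cubicDX c p q r + y * cubicDY c p q r + z * cubicDZ c p q r)
    (C := p * cubicDX c x y z + q * cubicDY c x y z + r * cubicDZ c x y z)
    (D := cubicEval c x y z) hP (fun t ht => by
      obtain ⟨e1, e2, e3⟩ := hs (t * p + x) (t * q + y) (t * r + z) (by
        rw [← ht]; simp only [cubicEval, cubicDX, cubicDY, cubicDZ]; ring)
      have : p * cubicDX c (t * p + x) (t * q + y) (t * r + z)
        + q * cubicDY c (t * p + x) (t * q + y) (t * r + z)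
        + r * cubicDZ c (t * p + x) (t * q + y) (t * r + z) = 0 := by simp [e1, e2, e3]
      rw [← this]; simp only [cubicEval, cubicDX, cubicDY, cubicDZ]; ring)
  exact ⟨t, h1, h3⟩

lemma exists_cubicEval_ne_zero {k : Type*} [Field k] [Infinite k] {c : Fin 10 → k} (hc : c ≠ 0) :
    ∃ x y z, cubicEval c x y z ≠ 0 := by
  by_contra! h
  exact hc (eq_zero_of_cubicEval_eq_zero h)

/-- Outside characteristic `3`, a nonzero ternary cubic over an algebraically closed field all of
whose zeros are singular is a multiple of the cube of the linear form `Q ↦ ∇c(P) · Q`, for any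
point `P` at which it does not vanish. -/
lemma exists_eq_cubeCoeff_of_singular {k : Type*} [Field k] [IsAlgClosed k] (h3 : (3 : k) ≠ 0)
    {c : Fin 10 → k} (hc : c ≠ 0)
    (hs : ∀ x y z, cubicEval c x y z = 0 →
      cubicDX c x y z = 0 ∧ cubicDY c x y z = 0 ∧ cubicDZ c x y z = 0) :
    ∃ a l m n, c = cubeCoeff a l m n := by
  have := IsAlgClosed.instInfinite (K := k)
  obtain ⟨p, q, r, hP⟩ := exists_cubicEval_ne_zero hc
  set A := cubicEval c p q r with hA
  refine ⟨1 / (27 * A ^ 2), cubicDX c p q r, cubicDY c p q r, cubicDZ c p q r, ?_⟩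
  rw [← sub_eq_zero]
  apply eq_zero_of_cubicEval_eq_zero
  intro x y z
  obtain ⟨t, h1, h2⟩ := restrict_eq_cube hs hP x y z
  have h27 : (27 : k) ≠ 0 := by
    have : (27 : k) = 3 ^ 3 := by norm_num
    rw [this]; exact pow_ne_zero _ h3
  have e : cubicEval (c - cubeCoeff (1 / (27 * A ^ 2)) (cubicDX c p q r) (cubicDY c p q r)
      (cubicDZ c p q r)) x y z = cubicEval c x y z - 1 / (27 * A ^ 2) *
      (x * cubicDX c p q r + y * cubicDY c p q r + z * cubicDZ c p q r) ^ 3 := by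
    simp [cubicEval, cubeCoeff]; ring
  rw [e, h1, h2, ← hA]
  field_simp
  ring

/-- In characteristic `3` a ternary cubic over an algebraically closed field all of whose zeros are
singular has all its partial derivatives identically zero, so it is a sum of cubes of monomials. -/
lemma coeff_eq_zero_of_singular {k : Type*} [Field k] [IsAlgClosed k] (h3 : (3 : k) = 0)
    {c : Fin 10 → k}
    (hs : ∀ x y z, cubicEval c x y z = 0 →
      cubicDX c x y z = 0 ∧ cubicDY c x y z = 0 ∧ cubicDZ c x y z = 0) :
    c 1 = 0 ∧ c 2 = 0 ∧ c 3 = 0 ∧ c 4 = 0 ∧ c 5 = 0 ∧ c 7 = 0 ∧ c 8 = 0 := by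
  have hall : ∀ x y z, cubicDX c x y z = 0 ∧ cubicDY c x y z = 0 ∧ cubicDZ c x y z = 0 := by
    intro p q r
    by_cases hP : cubicEval c p q r = 0
    · exact hs p q r hP
    · obtain ⟨t1, h1, -⟩ := restrict_eq_cube hs hP 1 0 0
      obtain ⟨t2, h2, -⟩ := restrict_eq_cube hs hP 0 1 0
      obtain ⟨t3, h3', -⟩ := restrict_eq_cube hs hP 0 0 1
      simp [h3] at h1 h2 h3'
      exact ⟨h1, h2, h3'⟩
  have hx := hall 1 0 0
  have hy := hall 0 1 0
  have hz := hall 0 0 1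
  have hyz := hall 0 1 1
  simp [cubicDX, cubicDY, cubicDZ, h3] at hx hy hz hyz
  obtain ⟨h1, h2⟩ := hx
  obtain ⟨h3, h7⟩ := hy
  obtain ⟨h5, h8⟩ := hz
  refine ⟨h1, h2, h3, ?_, h5, h7, h8⟩
  simpa [h3, h5] using hyz.1

/-- The cube `a(lX + mY + nZ)³`, normalised so that the first nonzero coefficient of the linear
form is `1`: the coefficient vectors of the triple lines of the projective plane. -/
def IsTripleLine {R : Type*} [CommRing R] (c : Fin 10 → R) : Prop :=
  (∃ a u v, a ≠ 0 ∧ c = cubeCoeff a 1 u v) ∨ (∃ a u, a ≠ 0 ∧ c = cubeCoeff a 0 1 u) ∨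
    ∃ a, a ≠ 0 ∧ c = cubeCoeff a 0 0 1

/-- A cubic form over a field `F` that becomes a multiple of a cube over an extension, in
characteristic different from `3`, is a triple line over `F`: the slopes of the line are
`b / 3a` and `c / 3a`. -/
lemma isTripleLine_of_map_eq_cubeCoeff {F k : Type*} [Field F] [Field k] [Algebra F k]
    (h3 : (3 : F) ≠ 0) {c : Fin 10 → F} (hc : c ≠ 0) {a l m n : k}
    (h : (fun i => algebraMap F k (c i)) = cubeCoeff a l m n) : IsTripleLine c := by
  have inj := (algebraMap F k).injective
  have h0 : algebraMap F k (c 0) = a * l ^ 3 := congrFun h 0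
  have h1 : algebraMap F k (c 1) = 3 * a * l ^ 2 * m := congrFun h 1
  have h2 : algebraMap F k (c 2) = 3 * a * l ^ 2 * n := congrFun h 2
  have h3' : algebraMap F k (c 3) = 3 * a * l * m ^ 2 := congrFun h 3
  have h4 : algebraMap F k (c 4) = 6 * a * l * m * n := congrFun h 4
  have h5 : algebraMap F k (c 5) = 3 * a * l * n ^ 2 := congrFun h 5
  have h6 : algebraMap F k (c 6) = a * m ^ 3 := congrFun h 6
  have h7 : algebraMap F k (c 7) = 3 * a * m ^ 2 * n := congrFun h 7
  have h8 : algebraMap F k (c 8) = 3 * a * m * n ^ 2 := congrFun h 8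
  have h9 : algebraMap F k (c 9) = a * n ^ 3 := congrFun h 9
  have h3k : (3 : k) ≠ 0 := by
    rw [← map_ofNat (algebraMap F k) 3]
    exact (map_ne_zero _).2 h3
  by_cases ha : a = 0
  · exact absurd (funext fun i => inj (by
      rw [show algebraMap F k (c i) = cubeCoeff a l m n i from congrFun h i, ha]
      fin_cases i <;> simp [cubeCoeff])) hc
  by_cases hl : l = 0
  · subst hl
    by_cases hm : m = 0
    · subst hm
      by_cases hn : n = 0
      · subst hn
        exact absurd (funext fun i => inj (by
          rw [show algebraMap F k (c i) = cubeCoeff a 0 0 0 i from congrFun h i]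
          fin_cases i <;> simp [cubeCoeff])) hc
      · refine Or.inr (Or.inr ⟨c 9, ?_, ?_⟩)
        · rw [← map_ne_zero (algebraMap F k), h9]; positivity
        · apply funext_fin10 <;> apply inj <;> simp [cubeCoeff, *]
    · have hg : c 6 ≠ 0 := by rw [← map_ne_zero (algebraMap F k), h6]; positivity
      refine Or.inr (Or.inl ⟨c 6, c 7 / (3 * c 6), hg, ?_⟩)
      apply funext_fin10 <;> apply inj <;> simp [cubeCoeff, map_ofNat, *] <;> field_simp
  · have hg : c 0 ≠ 0 := by rw [← map_ne_zero (algebraMap F k), h0]; positivity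
    refine Or.inl ⟨c 0, c 1 / (3 * c 0), c 2 / (3 * c 0), hg, ?_⟩
    apply funext_fin10 <;> apply inj <;> simp [cubeCoeff, map_ofNat, *] <;> field_simp

/-- The reduction dichotomy: a ternary cubic over `𝔽_p` has a smooth zero over the algebraic
closure, unless it is zero or a triple line defined over `𝔽_p`. -/
theorem exists_smooth_zero_or_isTripleLine {p : ℕ} [Fact p.Prime] {k : Type*} [Field k]
    [Algebra (ZMod p) k] [IsAlgClosed k] (c : Fin 10 → ZMod p) (hc : c ≠ 0)
    (hL : ¬ IsTripleLine c) :
    ∃ x y z : k, cubicEval (fun i => algebraMap (ZMod p) k (c i)) x y z = 0 ∧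
      (cubicDX (fun i => algebraMap (ZMod p) k (c i)) x y z ≠ 0 ∨
        cubicDY (fun i => algebraMap (ZMod p) k (c i)) x y z ≠ 0 ∨
        cubicDZ (fun i => algebraMap (ZMod p) k (c i)) x y z ≠ 0) := by
  by_contra! hs
  have inj := (algebraMap (ZMod p) k).injective
  apply hL
  by_cases h3 : (3 : ZMod p) = 0
  · have h3k : (3 : k) = 0 := by
      rw [← map_ofNat (algebraMap (ZMod p) k) 3, h3, map_zero]
    obtain ⟨h1, h2, h3', h4, h5, h7, h8⟩ := coeff_eq_zero_of_singular h3k hs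
    simp only [map_eq_zero] at h1 h2 h3' h4 h5 h7 h8
    have hp : p = 3 := by
      have : p ∣ 3 := (ZMod.natCast_eq_zero_iff 3 p).1 (by exact_mod_cast h3)
      exact (Nat.prime_dvd_prime_iff_eq Fact.out Nat.prime_three).1 this
    -- Every element of `𝔽_3` is its own cube.
    have hcube : ∀ x : ZMod p, x ^ 3 = x := by
      subst hp
      exact fun x => ZMod.pow_card x
    have h6' : (6 : ZMod p) = 0 := by linear_combination 2 * h3
    by_cases h0 : c 0 = 0
    · by_cases h6 : c 6 = 0
      · refine Or.inr (Or.inr ⟨c 9, fun h9 => hc (funext_fin10 h0 h1 h2 h3' h4 h5 h6 h7 h8 h9), ?_⟩)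
        apply funext_fin10 <;> simp [cubeCoeff, *]
      · refine Or.inr (Or.inl ⟨c 6, c 9 / c 6, h6, ?_⟩)
        apply funext_fin10 <;> simp [cubeCoeff, *]
        field_simp
    · refine Or.inl ⟨c 0, c 6 / c 0, c 9 / c 0, h0, ?_⟩
      apply funext_fin10 <;> simp [cubeCoeff, *] <;> field_simp
  · have h3k : (3 : k) ≠ 0 := by
      rw [← map_ofNat (algebraMap (ZMod p) k) 3]
      exact (map_ne_zero _).2 h3
    obtain ⟨a, l, m, n, h⟩ := exists_eq_cubeCoeff_of_singular h3k
      (c := fun i => algebraMap (ZMod p) k (c i))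
      (fun h => hc (funext fun i => inj (by simpa using congrFun h i))) hs
    exact isTripleLine_of_map_eq_cubeCoeff h3 hc h

/-! ### The maximal unramified extension -/

section Unramified

variable {p : ℕ} [Fact p.Prime]

lemma norm_algebraMap_padicInt (a : ℤ_[p]) : ‖algebraMap ℤ_[p] (PadicAlgCl p) a‖ = ‖a‖ := by
  rw [IsScalarTower.algebraMap_apply ℤ_[p] ℚ_[p] (PadicAlgCl p)]
  exact (PadicAlgCl.norm_extends p _)

lemma norm_natCast_prime : ‖(p : PadicAlgCl p)‖ = (p : ℝ)⁻¹ := by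
  have := norm_algebraMap_padicInt (p := p) (p : ℤ_[p])
  rw [map_natCast] at this
  rw [this]; simp

lemma natCast_prime_ne_zero : (p : PadicAlgCl p) ≠ 0 := by
  exact_mod_cast (Fact.out : p.Prime).ne_zero

lemma isIntegral_iff_norm_le_one (x : PadicAlgCl p) : IsIntegral ℤ_[p] x ↔ ‖x‖ ≤ 1 := by
  have hx : IsIntegral ℚ_[p] x := Algebra.IsIntegral.isIntegral x
  have hm := minpoly.monic hx
  rw [← PadicAlgCl.spectralNorm_eq, spectralNorm, spectralValue_le_one_iff hm]
  constructor
  · intro h n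
    rw [minpoly.isIntegrallyClosed_eq_field_fractions' ℚ_[p] h, Polynomial.coeff_map]
    exact PadicInt.norm_le_one _
  · intro h
    have : minpoly ℚ_[p] x ∈ Polynomial.lifts (algebraMap ℤ_[p] ℚ_[p]) := by
      rw [Polynomial.lifts_iff_coeff_lifts]
      exact fun n => ⟨⟨_, h n⟩, rfl⟩
    obtain ⟨q, hq, -, hqm⟩ := Polynomial.lifts_and_natDegree_eq_and_monic this hm
    refine ⟨q, hqm, ?_⟩
    have h2 := minpoly.aeval ℚ_[p] x
    rw [← hq, Polynomial.aeval_map_algebraMap] at h2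
    exact h2

/-- An element of norm less than `1` has a power divisible by `p` in any `ℤ_p`-order containing
it: the lower coefficients of its minimal polynomial are divisible by `p`. -/
lemma exists_pow_eq_prime_mul {A : Subalgebra ℤ_[p] (PadicAlgCl p)} {x : PadicAlgCl p}
    (hA : x ∈ A) (hx : ‖x‖ < 1) : ∃ n : ℕ, ∃ y ∈ A, x ^ n = p * y := by
  have hint := (isIntegral_iff_norm_le_one x).2 hx.le
  have hm := minpoly.monic hint
  have hcoef : ∀ i < (minpoly ℤ_[p] x).natDegree, (p : ℤ_[p]) ∣ (minpoly ℤ_[p] x).coeff i := by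
    intro i hi
    rw [← PadicInt.norm_lt_one_iff_dvd]
    by_contra! h1
    have h2 := le_ciSup (spectralValueTerms_bddAbove (minpoly ℚ_[p] x)) i
    have hQ := minpoly.isIntegrallyClosed_eq_field_fractions' ℚ_[p] hint
    have hdeg : (minpoly ℚ_[p] x).natDegree = (minpoly ℤ_[p] x).natDegree := by
      rw [hQ, hm.natDegree_map]
    rw [spectralValueTerms_of_lt_natDegree _ (hdeg ▸ hi), hQ, Polynomial.coeff_map, ← hQ] at h2
    have h3 : (1 : ℝ) ≤ ‖algebraMap ℤ_[p] ℚ_[p] ((minpoly ℤ_[p] x).coeff i)‖ ^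
        (1 / (((minpoly ℚ_[p] x).natDegree : ℝ) - i)) := by
      refine Real.one_le_rpow h1 (one_div_nonneg.2 (sub_nonneg.2 ?_))
      exact_mod_cast (hdeg ▸ hi).le
    have h4 : ‖x‖ = ⨆ n, spectralValueTerms (minpoly ℚ_[p] x) n := rfl
    linarith
  choose! b hb using hcoef
  have h0 := minpoly.aeval ℤ_[p] x
  rw [Polynomial.aeval_eq_sum_range, Finset.sum_range_succ, hm.coeff_natDegree, one_smul] at h0
  refine ⟨(minpoly ℤ_[p] x).natDegree,
    -∑ i ∈ Finset.range (minpoly ℤ_[p] x).natDegree, b i • x ^ i,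
    neg_mem (sum_mem fun i _ => A.smul_mem (pow_mem hA i) _), ?_⟩
  rw [eq_neg_of_add_eq_zero_right h0, mul_neg, Finset.mul_sum]
  congr 1
  refine Finset.sum_congr rfl fun i hi => ?_
  rw [hb i (Finset.mem_range.1 hi), mul_smul, Algebra.smul_def]
  simp

/-- A finite unramified `ℤ_p`-algebra inside the algebraic closure of `ℚ_p`. -/
def IsUnramifiedOrder (A : Subalgebra ℤ_[p] (PadicAlgCl p)) : Prop :=
  Module.Finite ℤ_[p] A ∧ Algebra.FormallyUnramified ℤ_[p] A

lemma IsUnramifiedOrder.norm_le_one {A : Subalgebra ℤ_[p] (PadicAlgCl p)}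
    (hA : IsUnramifiedOrder A) {x : PadicAlgCl p} (hx : x ∈ A) : ‖x‖ ≤ 1 := by
  have := hA.1
  rw [← isIntegral_iff_norm_le_one]
  exact (Algebra.IsIntegral.isIntegral (R := ℤ_[p]) (⟨x, hx⟩ : A)).map A.val

/-- In an unramified order an element of norm less than `1` is divisible by `p`, because the
quotient by `p` is reduced. -/
lemma IsUnramifiedOrder.exists_eq_prime_mul {A : Subalgebra ℤ_[p] (PadicAlgCl p)}
    (hA : IsUnramifiedOrder A) {x : PadicAlgCl p} (hx : x ∈ A) (h1 : ‖x‖ < 1) :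
    ∃ y ∈ A, x = p * y := by
  have := hA.1
  have := hA.2
  have hrad := Algebra.FormallyUnramified.isRadical_map_isMaximal _ A
    (IsLocalRing.maximalIdeal ℤ_[p])
  rw [PadicInt.maximalIdeal_eq_span_p, Ideal.map_span, Set.image_singleton, map_natCast] at hrad
  obtain ⟨n, y, hy, hn⟩ := exists_pow_eq_prime_mul hx h1
  have hmem : (⟨x, hx⟩ : A) ∈ Ideal.span {((p : ℕ) : A)} := by
    apply hrad
    refine ⟨n, Ideal.mem_span_singleton.2 ⟨⟨y, hy⟩, ?_⟩⟩
    apply Subtype.ext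
    simpa using hn
  obtain ⟨z, hz⟩ := Ideal.mem_span_singleton.1 hmem
  exact ⟨z, z.2, by simpa using congrArg Subtype.val hz⟩

lemma IsUnramifiedOrder.exists_eq_prime_pow_mul {A : Subalgebra ℤ_[p] (PadicAlgCl p)}
    (hA : IsUnramifiedOrder A) (n : ℕ) {x : PadicAlgCl p} (hx : (p : PadicAlgCl p) ^ n * x ∈ A)
    (h1 : ‖x‖ ≤ 1) : x ∈ A := by
  induction n with
  | zero => simpa using hx
  | succ n ih =>
    have hp1 : (p : ℝ)⁻¹ < 1 :=
      inv_lt_one_of_one_lt₀ (by exact_mod_cast (Fact.out : p.Prime).one_lt)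
    have hp0 : (0 : ℝ) ≤ (p : ℝ)⁻¹ := by positivity
    have : ‖(p : PadicAlgCl p) ^ (n + 1) * x‖ < 1 := by
      rw [norm_mul, norm_pow, norm_natCast_prime]
      calc (p : ℝ)⁻¹ ^ (n + 1) * ‖x‖ ≤ (p : ℝ)⁻¹ ^ (n + 1) * 1 := by gcongr
        _ < 1 := by rw [mul_one]; exact pow_lt_one₀ hp0 hp1 (by omega)
    obtain ⟨y, hy, he⟩ := hA.exists_eq_prime_mul hx this
    apply ih
    have : (p : PadicAlgCl p) ^ n * x = y :=
      mul_left_cancel₀ natCast_prime_ne_zero (by rw [← he]; ring)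
    rwa [this]

lemma IsUnramifiedOrder.sup {A B : Subalgebra ℤ_[p] (PadicAlgCl p)}
    (hA : IsUnramifiedOrder A) (hB : IsUnramifiedOrder B) : IsUnramifiedOrder (A ⊔ B) := by
  obtain ⟨_, _⟩ := hA
  obtain ⟨_, _⟩ := hB
  have h : (Algebra.TensorProduct.productMap A.val B.val).range = A ⊔ B := by
    rw [Algebra.TensorProduct.productMap_range, Subalgebra.range_val, Subalgebra.range_val]
  rw [← h]
  have hs := (Algebra.TensorProduct.productMap A.val B.val).rangeRestrict_surjective
  have : Algebra.FormallyUnramified ℤ_[p] (TensorProduct ℤ_[p] A B) :=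
    Algebra.FormallyUnramified.comp ℤ_[p] A _
  exact ⟨Module.Finite.of_surjective
    (Algebra.TensorProduct.productMap A.val B.val).rangeRestrict.toLinearMap hs,
    Algebra.FormallyUnramified.of_surjective _ hs⟩

/-- The field obtained from a `ℤ_p`-algebra `B` by inverting `p`. -/
def fractionField (B : Subalgebra ℤ_[p] (PadicAlgCl p)) :
    IntermediateField ℚ_[p] (PadicAlgCl p) :=
  let S : Subalgebra ℚ_[p] (PadicAlgCl p) :=
    { carrier := {x | ∃ n : ℕ, (p : PadicAlgCl p) ^ n * x ∈ B}
      mul_mem' := by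
        rintro x y ⟨n, hn⟩ ⟨m, hm⟩
        refine ⟨n + m, ?_⟩
        convert mul_mem hn hm using 1
        ring
      add_mem' := by
        rintro x y ⟨n, hn⟩ ⟨m, hm⟩
        refine ⟨n + m, ?_⟩
        have hp : (p : PadicAlgCl p) ∈ B := natCast_mem B p
        convert add_mem (mul_mem (pow_mem hp m) hn) (mul_mem (pow_mem hp n) hm) using 1
        ring
      algebraMap_mem' := by
        intro r
        obtain ⟨n, a, ha⟩ : ∃ n : ℕ, ∃ a : ℤ_[p], (p : ℚ_[p]) ^ n * r = a := by
          have hp1 : 1 < (p : ℝ) := by exact_mod_cast (Fact.out : p.Prime).one_lt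
          obtain ⟨n, hn⟩ := pow_unbounded_of_one_lt ‖r‖ hp1
          refine ⟨n, ⟨(p : ℚ_[p]) ^ n * r, ?_⟩, rfl⟩
          rw [norm_mul, norm_pow, Padic.norm_p, inv_pow, inv_mul_le_iff₀ (by positivity)]
          linarith
        refine ⟨n, ?_⟩
        have h := B.algebraMap_mem a
        rw [IsScalarTower.algebraMap_apply ℤ_[p] ℚ_[p] (PadicAlgCl p), PadicInt.algebraMap_apply,
          ← ha] at h
        simpa using h }
  S.toIntermediateField fun x hx => by
    exact Subalgebra.inv_mem_of_algebraic S (x := ⟨x, hx⟩) (Algebra.IsAlgebraic.isAlgebraic _)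

lemma mem_fractionField {B : Subalgebra ℤ_[p] (PadicAlgCl p)} {x : PadicAlgCl p} :
    x ∈ fractionField B ↔ ∃ n : ℕ, (p : PadicAlgCl p) ^ n * x ∈ B := Iff.rfl

variable (p) in
/-- The union of all unramified orders. It is closed under addition and multiplication because the
compositum of two unramified orders is unramified. -/
def unramifiedIntegers : Subalgebra ℤ_[p] (PadicAlgCl p) where
  carrier := {x | ∃ A : Subalgebra ℤ_[p] (PadicAlgCl p), IsUnramifiedOrder A ∧ x ∈ A}
  mul_mem' := by
    rintro x y ⟨A, hA, hx⟩ ⟨B, hB, hy⟩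
    exact ⟨A ⊔ B, hA.sup hB, mul_mem ((le_sup_left : A ≤ A ⊔ B) hx) ((le_sup_right : B ≤ A ⊔ B) hy)⟩
  add_mem' := by
    rintro x y ⟨A, hA, hx⟩ ⟨B, hB, hy⟩
    exact ⟨A ⊔ B, hA.sup hB, add_mem ((le_sup_left : A ≤ A ⊔ B) hx) ((le_sup_right : B ≤ A ⊔ B) hy)⟩
  algebraMap_mem' := fun r => by
    have hs := (Algebra.ofId ℤ_[p] (PadicAlgCl p)).rangeRestrict_surjective
    refine ⟨(Algebra.ofId ℤ_[p] (PadicAlgCl p)).range, ⟨?_, ?_⟩, r, rfl⟩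
    · exact Module.Finite.of_surjective
        (Algebra.ofId ℤ_[p] (PadicAlgCl p)).rangeRestrict.toLinearMap hs
    · exact Algebra.FormallyUnramified.of_surjective _ hs

instance (K : IntermediateField ℚ_[p] (PadicAlgCl p)) :
    IsScalarTower ℤ_[p] K (PadicAlgCl p) :=
  IsScalarTower.of_algebraMap_eq fun _ => rfl

lemma IsFiniteUnramified.isUnramifiedOrder {K : IntermediateField ℚ_[p] (PadicAlgCl p)}
    (hK : IsFiniteUnramified p K) : IsUnramifiedOrder
      ((integralClosure ℤ_[p] K).map (IsScalarTower.toAlgHom ℤ_[p] K (PadicAlgCl p))) := by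
  obtain ⟨_, _⟩ := hK
  have e := (integralClosure ℤ_[p] K).equivMapOfInjective
    (IsScalarTower.toAlgHom ℤ_[p] K (PadicAlgCl p)) (algebraMap K (PadicAlgCl p)).injective
  have : Module.Finite ℤ_[p] (integralClosure ℤ_[p] K) :=
    IsIntegralClosure.finite ℤ_[p] ℚ_[p] K _
  exact ⟨Module.Finite.equiv e.toLinearEquiv, Algebra.FormallyUnramified.of_equiv e⟩

lemma exists_norm_prime_pow_mul_le_one (x : PadicAlgCl p) :
    ∃ n : ℕ, ‖(p : PadicAlgCl p) ^ n * x‖ ≤ 1 := by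
  have hp1 : 1 < (p : ℝ) := by exact_mod_cast (Fact.out : p.Prime).one_lt
  obtain ⟨n, hn⟩ := pow_unbounded_of_one_lt ‖x‖ hp1
  refine ⟨n, ?_⟩
  rw [norm_mul, norm_pow, norm_natCast_prime, inv_pow, inv_mul_le_iff₀ (by positivity)]
  linarith

lemma maxUnramified_le : maxUnramified p ≤ fractionField (unramifiedIntegers p) := by
  refine iSup₂_le fun K hK x hx => ?_
  obtain ⟨n, hn⟩ := exists_norm_prime_pow_mul_le_one x
  have hmem : (p : PadicAlgCl p) ^ n * x ∈ K := mul_mem (pow_mem (natCast_mem K p) n) hx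
  refine mem_fractionField.2 ⟨n, _, hK.isUnramifiedOrder, ?_⟩
  refine ⟨⟨_, hmem⟩, ?_, rfl⟩
  rw [← isIntegral_iff_norm_le_one] at hn
  exact (isIntegral_algebraMap_iff (algebraMap K (PadicAlgCl p)).injective).1 hn

/-- The extension `ℚ_p^nr` is unramified: an element of norm less than `1` is divisible by `p`. -/
theorem norm_le_inv_of_norm_lt_one {x : PadicAlgCl p} (hx : x ∈ maxUnramified p) (h1 : ‖x‖ < 1) :
    ‖x‖ ≤ (p : ℝ)⁻¹ := by
  obtain ⟨n, A, hA, hn⟩ := mem_fractionField.1 (maxUnramified_le hx)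
  obtain ⟨y, hy, rfl⟩ := hA.exists_eq_prime_mul (hA.exists_eq_prime_pow_mul n hn h1.le) h1
  rw [norm_mul, norm_natCast_prime]
  exact mul_le_of_le_one_right (by positivity) (hA.norm_le_one hy)

end Unramified

/-! ### Lifting smooth points -/

section Hensel

open Polynomial

/-- A finite module over a complete Noetherian ring is complete, provided it is separated. -/
lemma isAdicComplete_of_finite {R M : Type*} [CommRing R] [AddCommGroup M] [Module R M]
    (J : Ideal R) [IsAdicComplete J R] [Module.Finite R M] [IsHausdorff J M] :
    IsAdicComplete J M := by
  have hpre : IsPrecomplete J M := by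
    rw [← AdicCompletion.of_surjective_iff]
    intro y
    obtain ⟨t, rfl⟩ := AdicCompletion.ofTensorProduct_surjective_of_finite J M y
    induction t with
    | zero => exact ⟨0, by simp⟩
    | add a b ha hb =>
      obtain ⟨u, hu⟩ := ha
      obtain ⟨v, hv⟩ := hb
      exact ⟨u + v, by rw [map_add, map_add, hu, hv]⟩
    | tmul r m =>
      obtain ⟨s, rfl⟩ := AdicCompletion.of_surjective J R r
      refine ⟨s • m, ?_⟩
      rw [AdicCompletion.ofTensorProduct_tmul, map_smul]
      ext n
      rfl
  exact { }

lemma formallyUnramified_adjoinRoot {R : Type*} [CommRing R] {f : R[X]}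
    (h : IsUnit (aeval (AdjoinRoot.root f) (derivative f))) :
    Algebra.FormallyUnramified R (AdjoinRoot f) := by
  rw [Algebra.FormallyUnramified.iff_comp_injective]
  intro B _ _ I hI g₁ g₂ hg
  apply AdjoinRoot.algHom_ext
  set a := g₁ (AdjoinRoot.root f) with ha
  set b := g₂ (AdjoinRoot.root f) with hb
  have h0 : aeval (AdjoinRoot.root f) f = 0 := by simp
  have hfa : aeval a f = 0 := by rw [ha, aeval_algHom_apply, h0, map_zero]
  have hfb : aeval b f = 0 := by rw [hb, aeval_algHom_apply, h0, map_zero]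
  have hua : IsUnit (aeval a (derivative f)) := by
    rw [ha, aeval_algHom_apply]; exact h.map g₁
  have hI' : b - a ∈ I := by
    rw [← Ideal.Quotient.eq]
    exact (DFunLike.congr_fun hg (AdjoinRoot.root f)).symm
  have hsq : (b - a) ^ 2 = 0 := by
    have : (b - a) ^ 2 ∈ I ^ 2 := Ideal.pow_mem_pow hI' 2
    rwa [hI, Ideal.mem_bot] at this
  obtain ⟨c, hc⟩ := exists_mul_sq_add_linear_part_eq_eval_add
    (f.map (algebraMap R B)) a (b - a)
  rw [hsq, add_sub_cancel, eval_map_algebraMap, eval_map_algebraMap, derivative_map,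
    eval_map_algebraMap, hfa, hfb] at hc
  have : aeval a (derivative f) * (b - a) = 0 := by linear_combination hc
  exact (sub_eq_zero.1 (hua.mul_right_eq_zero.1 this)).symm

/-- Three elements of an algebraic closure of `𝔽_p` lie in `𝔽_p[α]` for a single `α`. -/
lemma exists_aeval_eq {p : ℕ} [Fact p.Prime] {k : Type*} [Field k] [Algebra (ZMod p) k]
    [Algebra.IsAlgebraic (ZMod p) k] (x y z : k) :
    ∃ α : k, (∃ P : (ZMod p)[X], aeval α P = x) ∧ (∃ P : (ZMod p)[X], aeval α P = y) ∧
      ∃ P : (ZMod p)[X], aeval α P = z := by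
  let E := IntermediateField.adjoin (ZMod p) ({x, y, z} : Set k)
  have hfin : FiniteDimensional (ZMod p) E :=
    IntermediateField.finiteDimensional_adjoin fun x _ => Algebra.IsIntegral.isIntegral x
  obtain ⟨α, hα⟩ := Field.exists_primitive_element (ZMod p) E
  have key : ∀ e : E, ∃ P : (ZMod p)[X], aeval (α : k) P = e := by
    intro e
    have he : e ∈ IntermediateField.adjoin (ZMod p) {α} := by rw [hα]; trivial
    rw [← IntermediateField.mem_toSubalgebra,
      IntermediateField.adjoin_simple_toSubalgebra_of_isAlgebraic
        (Algebra.IsAlgebraic.isAlgebraic α), Algebra.adjoin_singleton_eq_range_aeval] at he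
    obtain ⟨P, hP⟩ := he
    refine ⟨P, ?_⟩
    rw [← hP]
    exact aeval_algebraMap_apply k α P
  have hsub := IntermediateField.subset_adjoin (ZMod p) ({x, y, z} : Set k)
  exact ⟨α, key ⟨x, hsub (by simp)⟩, key ⟨y, hsub (by simp)⟩, key ⟨z, hsub (by simp)⟩⟩

/-- Hensel's lemma for a cubic polynomial `αT³ + βT² + γT + δ` that need not be monic: with
`e = F(t₀)` and `d = F'(t₀)`, the substitution `t = t₀ + e / η` turns it into the monic cubic
`η³ + dη² + (3αt₀ + β)eη + αe²`, which has the simple root `-d` modulo the ideal. -/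
lemma exists_root_cubic {A : Type*} [CommRing A] (I : Ideal A) [HenselianRing A I]
    (α β γ δ t₀ : A) (h0 : α * t₀ ^ 3 + β * t₀ ^ 2 + γ * t₀ + δ ∈ I)
    (h1 : IsUnit (3 * α * t₀ ^ 2 + 2 * β * t₀ + γ)) :
    ∃ t, α * t ^ 3 + β * t ^ 2 + γ * t + δ = 0 ∧ t - t₀ ∈ I := by
  set e := α * t₀ ^ 3 + β * t₀ ^ 2 + γ * t₀ + δ with he
  set d := 3 * α * t₀ ^ 2 + 2 * β * t₀ + γ with hd
  set q := 3 * α * t₀ + β with hq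
  have hloc := isLocalHom_of_le_jacobson_bot I HenselianRing.jac
  let f : A[X] := X ^ 3 + C d * X ^ 2 + C (q * e) * X + C (α * e ^ 2)
  have hm : f.Monic := by simp only [f]; monicity!
  obtain ⟨η, hη, hηI⟩ := HenselianRing.is_henselian (I := I) f hm (-d) (by
      have : eval (-d) f = e * (-q * d + α * e) := by simp [f]; ring
      rw [this]
      exact I.mul_mem_right _ h0) (by
      have : eval (-d) (derivative f) = d ^ 2 + q * e := by
        simp [f, -map_pow, -map_mul]; ring
      rw [this, map_add, Ideal.Quotient.eq_zero_iff_mem.2 (I.mul_mem_left q h0), add_zero]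
      exact (h1.pow 2).map _)
  have hu : IsUnit η := by
    apply IsUnit.of_map (Ideal.Quotient.mk I)
    rw [show Ideal.Quotient.mk I η = Ideal.Quotient.mk I (-d) from
      (Ideal.Quotient.eq).2 hηI]
    exact h1.neg.map _
  obtain ⟨w, hw⟩ := hu.exists_right_inv
  refine ⟨t₀ + e * w, ?_, by simpa using I.mul_mem_right w h0⟩
  have hη' : η ^ 3 + d * η ^ 2 + q * e * η + α * e ^ 2 = 0 := by
    simpa [f] using hη
  have : α * (t₀ + e * w) ^ 3 + β * (t₀ + e * w) ^ 2 + γ * (t₀ + e * w) + δ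
      = e + d * (e * w) + q * (e * w) ^ 2 + α * (e * w) ^ 3 := by
    rw [he, hd, hq]; ring
  rw [this]
  -- Homogenise with `1 = η w`.
  have : e + d * (e * w) + q * (e * w) ^ 2 + α * (e * w) ^ 3
      = e * (η * w) ^ 3 + d * (e * w) * (η * w) ^ 2 + q * (e * w) ^ 2 * (η * w)
        + α * (e * w) ^ 3 := by rw [hw]; ring
  rw [this]
  linear_combination e * w ^ 3 * hη'

end Hensel

/-! ### Unramified lifts of finite fields -/

section Lift

open Polynomial

variable {p : ℕ} [Fact p.Prime]

lemma toZMod_surjective : Function.Surjective (PadicInt.toZMod (p := p)) :=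
  ZMod.ringHom_surjective _

lemma toZMod_eq_zero_iff (a : ℤ_[p]) : PadicInt.toZMod a = 0 ↔ (p : ℤ_[p]) ∣ a := by
  rw [← RingHom.mem_ker, PadicInt.ker_toZMod, PadicInt.maximalIdeal_eq_span_p,
    Ideal.mem_span_singleton]

lemma exists_eq_C_mul_of_map_toZMod_eq_zero {P : ℤ_[p][X]} (h : P.map PadicInt.toZMod = 0) :
    ∃ Q, P = C (p : ℤ_[p]) * Q := by
  have : C (p : ℤ_[p]) ∣ P := by
    rw [C_dvd_iff_dvd_coeff]
    intro i
    rw [← toZMod_eq_zero_iff, ← coeff_map, h, coeff_zero]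
  exact this

lemma map_toZMod_surjective : Function.Surjective (Polynomial.map (PadicInt.toZMod (p := p))) :=
  Polynomial.map_surjective _ toZMod_surjective

/-- The field generated by the image of an unramified order is finite unramified, so it lies in
`ℚ_p^nr`: its ring of integers is the order itself. -/
lemma IsUnramifiedOrder.le_maxUnramified {B : Subalgebra ℤ_[p] (PadicAlgCl p)}
    (hB : IsUnramifiedOrder B) : (B : Set (PadicAlgCl p)) ⊆ maxUnramified p := by
  obtain ⟨s, hs⟩ := hB.1.fg_top
  have hsub : B ≤ (fractionField B).toSubalgebra.restrictScalars ℤ_[p] := by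
    intro x hx
    exact mem_fractionField.2 ⟨0, by simpa using hx⟩
  let K := fractionField B
  have hsubset : ∀ x ∈ B, x ∈ K := fun x hx => hsub hx
  have hBK : (integralClosure ℤ_[p] K).map (IsScalarTower.toAlgHom ℤ_[p] K (PadicAlgCl p)) = B := by
    ext x
    constructor
    · rintro ⟨y, hy, rfl⟩
      obtain ⟨n, hn⟩ := mem_fractionField.1 y.2
      refine hB.exists_eq_prime_pow_mul n hn ?_
      rw [← isIntegral_iff_norm_le_one]
      exact (isIntegral_algebraMap_iff (algebraMap K (PadicAlgCl p)).injective).2 hy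
    · intro hx
      refine ⟨⟨x, hsubset x hx⟩, ?_, rfl⟩
      refine (isIntegral_algebraMap_iff (algebraMap K (PadicAlgCl p)).injective).1 ?_
      rw [isIntegral_iff_norm_le_one]
      exact hB.norm_le_one hx
  have e := ((integralClosure ℤ_[p] K).equivMapOfInjective
    (IsScalarTower.toAlgHom ℤ_[p] K (PadicAlgCl p))
    (algebraMap K (PadicAlgCl p)).injective).trans (Subalgebra.equivOfEq _ _ hBK)
  have := hB.2
  have hfin : FiniteDimensional ℚ_[p] K := by
    have := hB.1
    -- `p`-power multiples of elements of `K` are `ℤ_p`-combinations of the generators of `B`.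
    have : (Submodule.span ℚ_[p] (Subtype.val '' (s : Set B))) =
        Subalgebra.toSubmodule K.toSubalgebra := by
      apply le_antisymm
      · rw [Submodule.span_le]
        rintro _ ⟨b, -, rfl⟩
        exact hsubset b b.2
      · intro x hx
        obtain ⟨n, hn⟩ := mem_fractionField.1 hx
        have h1 : (⟨_, hn⟩ : B) ∈ Submodule.span ℤ_[p] (s : Set B) := by rw [hs]; trivial
        have h2 := Submodule.mem_map_of_mem (f := B.val.toLinearMap) h1
        rw [Submodule.map_span] at h2
        have h3 := Submodule.span_le_restrictScalars ℤ_[p] ℚ_[p] _ h2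
        have h4 := Submodule.smul_mem (Submodule.span ℚ_[p] (Subtype.val '' (s : Set B)))
          (((p : ℚ_[p]) ^ n)⁻¹) h3
        have hp0 : (p : PadicAlgCl p) ^ n ≠ 0 := pow_ne_zero _ natCast_prime_ne_zero
        convert h4 using 1
        simp [Algebra.smul_def, hp0]
    have h5 : FiniteDimensional ℚ_[p]
        (Submodule.span ℚ_[p] (Subtype.val '' (s : Set B))) :=
      FiniteDimensional.span_of_finite _ (s.finite_toSet.image _)
    rw [this] at h5
    exact h5
  have hK : IsFiniteUnramified p K := ⟨hfin, Algebra.FormallyUnramified.of_equiv e.symm⟩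
  intro x hx
  exact (le_iSup₂ (f := fun (K : IntermediateField ℚ_[p] (PadicAlgCl p))
    (_ : IsFiniteUnramified p K) => K) K hK) (hsubset x hx)

/-- Any three elements of an algebraic closure `k` of `𝔽_p` lift to a Henselian unramified
`ℤ_p`-algebra `A` with a map to the integers of `ℚ_p^nr`: `A = ℤ_p[T] / f` for a monic lift `f` of
a minimal polynomial over `𝔽_p`. -/
theorem exists_unramified_lift {k : Type*} [Field k] [Algebra (ZMod p) k]
    [Algebra.IsAlgebraic (ZMod p) k] (x y z : k) :
    ∃ (A : Type) (_ : CommRing A) (_ : Algebra ℤ_[p] A) (ρ : A →+* k)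
      (ι : A →ₐ[ℤ_[p]] PadicAlgCl p),
      HenselianRing A (Ideal.span {(p : A)}) ∧
      (∀ a : ℤ_[p], ρ (algebraMap ℤ_[p] A a) = algebraMap (ZMod p) k (PadicInt.toZMod a)) ∧
      (∃ a, ρ a = x) ∧ (∃ a, ρ a = y) ∧ (∃ a, ρ a = z) ∧
      (∀ a, ρ a = 0 ↔ a ∈ Ideal.span {(p : A)}) ∧ (∀ a, ρ a ≠ 0 → IsUnit a) ∧
      ∀ a, ι a ∈ maxUnramified p := by
  obtain ⟨α, ⟨Px, hPx⟩, ⟨Py, hPy⟩, Pz, hPz⟩ := exists_aeval_eq (p := p) x y z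
  have hαint : IsIntegral (ZMod p) α := Algebra.IsIntegral.isIntegral α
  set m := minpoly (ZMod p) α with hm
  have hmm : m.Monic := minpoly.monic hαint
  have hlift : m ∈ lifts (PadicInt.toZMod (p := p)) := map_toZMod_surjective m
  obtain ⟨f, hfm, hfd, hf⟩ := lifts_and_natDegree_eq_and_monic hlift hmm
  let r : ℤ_[p] →+* k := (algebraMap (ZMod p) k).comp PadicInt.toZMod
  have hr : ∀ P : ℤ_[p][X], P.eval₂ r α = aeval α (P.map PadicInt.toZMod) := by
    intro P
    rw [aeval_def, eval₂_map]
  let A := AdjoinRoot f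
  let ρ : A →+* k := AdjoinRoot.lift r α (by rw [hr, hfm]; exact minpoly.aeval _ _)
  have hρmk : ∀ P, ρ (AdjoinRoot.mk f P) = aeval α (P.map PadicInt.toZMod) := by
    intro P
    rw [← hr]
    exact AdjoinRoot.lift_mk _ _
  have hsurj : ∀ P : (ZMod p)[X], ∃ a, ρ a = aeval α P := by
    intro P
    obtain ⟨Q, rfl⟩ := map_toZMod_surjective P
    exact ⟨_, hρmk Q⟩
  have hρalg : ∀ a : ℤ_[p], ρ (algebraMap ℤ_[p] A a)
      = algebraMap (ZMod p) k (PadicInt.toZMod a) := by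
    intro a
    exact AdjoinRoot.lift_of _
  have hker : ∀ a, ρ a = 0 ↔ a ∈ Ideal.span {(p : A)} := by
    intro a
    rw [Ideal.mem_span_singleton]
    constructor
    · intro h
      obtain ⟨P, rfl⟩ := AdjoinRoot.mk_surjective a
      rw [hρmk] at h
      obtain ⟨Q, hQ⟩ := minpoly.dvd _ _ h
      obtain ⟨Q, rfl⟩ := map_toZMod_surjective Q
      obtain ⟨R, hR⟩ := exists_eq_C_mul_of_map_toZMod_eq_zero (P := P - f * Q) (by
        rw [Polynomial.map_sub, Polynomial.map_mul, hfm, hQ, sub_self])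
      refine ⟨AdjoinRoot.mk f R, ?_⟩
      have := congrArg (AdjoinRoot.mk f) hR
      rw [map_sub, map_mul, map_mul, AdjoinRoot.mk_self, zero_mul, sub_zero] at this
      rw [this]
      simp
    · rintro ⟨b, rfl⟩
      have := hρalg p
      rw [map_natCast, map_natCast] at this
      rw [map_mul, map_natCast, ← map_natCast (algebraMap (ZMod p) k)]
      simp
  have hfin : Module.Finite ℤ_[p] A := hf.finite_adjoinRoot
  have hcomp : IsAdicComplete (Ideal.span {(p : A)}) A := by
    have h1 : IsAdicComplete (IsLocalRing.maximalIdeal ℤ_[p]) A := isAdicComplete_of_finite _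
    have h2 := (IsAdicComplete.map_algebraMap_iff (S := A) (M := A)
      (I := IsLocalRing.maximalIdeal ℤ_[p])).2 h1
    rwa [PadicInt.maximalIdeal_eq_span_p, Ideal.map_span, Set.image_singleton, map_natCast] at h2
  have hhens : HenselianRing A (Ideal.span {(p : A)}) := inferInstance
  have hunit : ∀ a, ρ a ≠ 0 → IsUnit a := by
    intro a ha
    have hloc := isLocalHom_of_le_jacobson_bot (Ideal.span {(p : A)}) HenselianRing.jac
    -- The image of `ρ` is the field `𝔽_p[α]`.
    obtain ⟨b, hb⟩ : ∃ b, ρ b = (ρ a)⁻¹ := by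
      obtain ⟨P, rfl⟩ := AdjoinRoot.mk_surjective a
      have hmem : ρ (AdjoinRoot.mk f P) ∈ Algebra.adjoin (ZMod p) {α} := by
        rw [hρmk]; exact aeval_mem_adjoin_singleton _ _
      have : (ρ (AdjoinRoot.mk f P))⁻¹ ∈ Algebra.adjoin (ZMod p) {α} :=
        Subalgebra.inv_mem_of_algebraic (Algebra.adjoin (ZMod p) {α}) (x := ⟨_, hmem⟩)
          (Algebra.IsAlgebraic.isAlgebraic _)
      rw [Algebra.adjoin_singleton_eq_range_aeval] at this
      obtain ⟨Q, hQ⟩ := this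
      obtain ⟨b, hb⟩ := hsurj Q
      exact ⟨b, hb.trans hQ⟩
    apply IsUnit.of_map (Ideal.Quotient.mk (Ideal.span {(p : A)}))
    refine IsUnit.of_mul_eq_one (Ideal.Quotient.mk _ b) ?_
    rw [← map_mul, ← map_one (Ideal.Quotient.mk _), Ideal.Quotient.eq, ← hker, map_sub, map_mul,
      hb, map_one, mul_inv_cancel₀ ha, sub_self]
  have hunram : Algebra.FormallyUnramified ℤ_[p] A := by
    apply formallyUnramified_adjoinRoot
    apply hunit
    rw [AdjoinRoot.aeval_eq, hρmk, ← derivative_map, hfm]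
    have hsep : m.Separable := PerfectField.separable_of_irreducible (minpoly.irreducible hαint)
    exact hsep.aeval_derivative_ne_zero (minpoly.aeval _ _)
  have hdeg : f.degree ≠ 0 := by
    rw [degree_eq_natDegree hf.ne_zero, hfd]
    exact_mod_cast (minpoly.natDegree_pos hαint).ne'
  obtain ⟨θ, hθ⟩ := IsAlgClosed.exists_eval₂_eq_zero_of_injective
    (algebraMap ℤ_[p] (PadicAlgCl p)) ((injective_iff_map_eq_zero _).2 fun a ha => by
      rw [← norm_eq_zero, ← norm_algebraMap_padicInt, ha, norm_zero]) f hdeg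
  let ι : A →ₐ[ℤ_[p]] PadicAlgCl p :=
    AdjoinRoot.liftAlgHom f (Algebra.ofId ℤ_[p] (PadicAlgCl p)) θ hθ
  have hιo : IsUnramifiedOrder ι.range :=
    ⟨Module.Finite.of_surjective ι.rangeRestrict.toLinearMap ι.rangeRestrict_surjective,
      Algebra.FormallyUnramified.of_surjective _ ι.rangeRestrict_surjective⟩
  exact ⟨A, inferInstance, inferInstance, ρ, ι, hhens, hρalg, hPx ▸ hsurj Px, hPy ▸ hsurj Py,
    hPz ▸ hsurj Pz, hker, hunit, fun a => hιo.le_maxUnramified ⟨a, rfl⟩⟩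

end Lift

section Points

variable {p : ℕ} [Fact p.Prime]

/-! ### Soluble and insoluble cubics -/

lemma hasPoint_maxUnramified_iff {R : Type*} [CommRing R]
    [Algebra R (maxUnramified p)] [Algebra R (PadicAlgCl p)]
    [IsScalarTower R (maxUnramified p) (PadicAlgCl p)] (c : Fin 10 → R) :
    HasPoint c (maxUnramified p) ↔ ∃ x ∈ maxUnramified p, ∃ y ∈ maxUnramified p,
      ∃ z ∈ maxUnramified p, (x ≠ 0 ∨ y ≠ 0 ∨ z ≠ 0) ∧
        cubicEval (fun i => algebraMap R (PadicAlgCl p) (c i)) x y z = 0 := by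
  have key : ∀ x y z : maxUnramified p,
      ((cubicEval (fun i => algebraMap R (maxUnramified p) (c i)) x y z : maxUnramified p) :
        PadicAlgCl p) = cubicEval (fun i => algebraMap R (PadicAlgCl p) (c i)) x y z := by
    intro x y z
    have := map_cubicEval (algebraMap (maxUnramified p) (PadicAlgCl p))
      (fun i => algebraMap R (maxUnramified p) (c i)) x y z
    simp only [← IsScalarTower.algebraMap_apply R (maxUnramified p) (PadicAlgCl p)] at this
    exact this
  rw [hasPoint_iff]
  constructor
  · rintro ⟨x, y, z, h, h0⟩
    refine ⟨x, x.2, y, y.2, z, z.2, by simpa using h, ?_⟩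
    rw [← key, h0]; rfl
  · rintro ⟨x, hx, y, hy, z, hz, h, h0⟩
    refine ⟨⟨x, hx⟩, ⟨y, hy⟩, ⟨z, hz⟩, ?_, ?_⟩
    · simpa [← Subtype.coe_ne_coe] using h
    · apply Subtype.ext
      rw [key]; exact h0

/-- A cubic form over `ℤ_p` is soluble over `ℚ_p^nr` as soon as its reduction is neither zero nor a
triple line: a smooth point over the algebraic closure of the residue field lifts by Hensel's
lemma. -/
theorem hasPoint_of_reduction (c : Fin 10 → ℤ_[p])
    (h0 : (fun i => PadicInt.toZMod (c i)) ≠ 0)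
    (hL : ¬ IsTripleLine fun i => PadicInt.toZMod (c i)) : HasPoint c (maxUnramified p) := by
  obtain ⟨x, y, z, hxyz, hs⟩ := exists_smooth_zero_or_isTripleLine
    (k := AlgebraicClosure (ZMod p)) _ h0 hL
  obtain ⟨A, _, _, ρ, ι, hH, hρ, ⟨x, rfl⟩, ⟨y, rfl⟩, ⟨z, rfl⟩, hker, hunit, hι⟩ :=
    exists_unramified_lift (p := p) x y z
  set C : Fin 10 → A := fun i => algebraMap ℤ_[p] A (c i) with hC
  have hρC : (fun i => algebraMap (ZMod p) (AlgebraicClosure (ZMod p)) (PadicInt.toZMod (c i)))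
      = fun i => ρ (C i) := funext fun i => (hρ _).symm
  rw [hρC, ← map_cubicDX, ← map_cubicDY, ← map_cubicDZ] at hs
  rw [hρC, ← map_cubicEval, hker] at hxyz
  have hcongr : ∀ {s t}, s - t ∈ Ideal.span {(p : A)} → ρ s = ρ t := by
    intro s t h
    rw [← sub_eq_zero, ← map_sub, hker]; exact h
  have hne : ρ x ≠ 0 ∨ ρ y ≠ 0 ∨ ρ z ≠ 0 := by
    by_contra! h
    simp only [map_cubicDX, map_cubicDY, map_cubicDZ, h.1, h.2.1, h.2.2] at hs
    simp [cubicDX, cubicDY, cubicDZ] at hs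
  have hι0 : ∀ a, ρ a ≠ 0 → ι a ≠ 0 := fun a ha => ((hunit a ha).map ι).ne_zero
  obtain ⟨x', y', z', he, h1, h2, h3⟩ : ∃ x' y' z' : A, cubicEval C x' y' z' = 0 ∧
      ρ x' = ρ x ∧ ρ y' = ρ y ∧ ρ z' = ρ z := by
    rcases hs with hs | hs | hs
    · obtain ⟨t, ht, htx⟩ := exists_root_cubic (Ideal.span {(p : A)}) (C 0) (C 1 * y + C 2 * z)
        (C 3 * y ^ 2 + C 4 * y * z + C 5 * z ^ 2)
        (C 6 * y ^ 3 + C 7 * y ^ 2 * z + C 8 * y * z ^ 2 + C 9 * z ^ 3) x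
        (by convert hxyz using 1; simp only [cubicEval]; ring)
        (by convert hunit _ hs using 1; simp only [cubicDX]; ring)
      exact ⟨t, y, z, by rw [← ht]; simp only [cubicEval]; ring, hcongr htx, rfl, rfl⟩
    · obtain ⟨t, ht, htx⟩ := exists_root_cubic (Ideal.span {(p : A)}) (C 6) (C 3 * x + C 7 * z)
        (C 1 * x ^ 2 + C 4 * x * z + C 8 * z ^ 2)
        (C 0 * x ^ 3 + C 2 * x ^ 2 * z + C 5 * x * z ^ 2 + C 9 * z ^ 3) y
        (by convert hxyz using 1; simp only [cubicEval]; ring)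
        (by convert hunit _ hs using 1; simp only [cubicDY]; ring)
      exact ⟨x, t, z, by rw [← ht]; simp only [cubicEval]; ring, rfl, hcongr htx, rfl⟩
    · obtain ⟨t, ht, htx⟩ := exists_root_cubic (Ideal.span {(p : A)}) (C 9) (C 5 * x + C 8 * y)
        (C 2 * x ^ 2 + C 4 * x * y + C 7 * y ^ 2)
        (C 0 * x ^ 3 + C 1 * x ^ 2 * y + C 3 * x * y ^ 2 + C 6 * y ^ 3) z
        (by convert hxyz using 1; simp only [cubicEval]; ring)
        (by convert hunit _ hs using 1; simp only [cubicDZ]; ring)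
      exact ⟨x, y, t, by rw [← ht]; simp only [cubicEval]; ring, rfl, rfl, hcongr htx⟩
  rw [← h1, ← h2, ← h3] at hne
  refine (hasPoint_maxUnramified_iff c).2 ⟨ι x', hι _, ι y', hι _, ι z', hι _,
    hne.imp (hι0 _) (Or.imp (hι0 _) (hι0 _)), ?_⟩
  have := map_cubicEval (ι : A →+* PadicAlgCl p) C x' y' z'
  rw [he, map_zero] at this
  rw [this]
  simp [hC]

/-- The lower bounds for the valuations of the coefficients of a critical form, attained at `X³`,
`Y³` and `Z³`. -/
def critVal : Fin 10 → ℕ := ![0, 1, 1, 1, 1, 2, 1, 2, 2, 2]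

/-- The critical forms: the coefficients of `X³`, `Y³`, `Z³` have valuations exactly `0`, `1`, `2`,
and the other coefficients are so divisible that at any zero these three monomials would
dominate. -/
def IsCritical (c : Fin 10 → ℚ_[p]) : Prop :=
  ∀ i, ‖c i‖ ≤ ((p : ℝ)⁻¹) ^ critVal i ∧
    (i ∈ ({0, 6, 9} : Finset (Fin 10)) → ‖c i‖ = ((p : ℝ)⁻¹) ^ critVal i)

lemma exists_eq_prime_pow_mul_of_norm_le {x : PadicAlgCl p} {n : ℕ} (h : ‖x‖ ≤ ((p : ℝ)⁻¹) ^ n) :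
    ∃ y : integralClosure ℤ_[p] (PadicAlgCl p), x = (p : PadicAlgCl p) ^ n * y := by
  have hp0 : (p : PadicAlgCl p) ^ n ≠ 0 := pow_ne_zero _ natCast_prime_ne_zero
  have hpp : (0 : ℝ) < p := by exact_mod_cast (Fact.out : p.Prime).pos
  refine ⟨⟨((p : PadicAlgCl p) ^ n)⁻¹ * x, ?_⟩, by field_simp⟩
  refine (isIntegral_iff_norm_le_one _).2 ?_
  rw [norm_mul, norm_inv, norm_pow, norm_natCast_prime]
  rw [inv_mul_le_iff₀ (by positivity)]
  simpa using h

lemma prime_dvd_of_dvd_mul_cube {x u : integralClosure ℤ_[p] (PadicAlgCl p)}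
    (hx : (x : PadicAlgCl p) ∈ maxUnramified p) (hu : ‖(u : PadicAlgCl p)‖ = 1)
    (h : (p : integralClosure ℤ_[p] (PadicAlgCl p)) ∣ u * x ^ 3) :
    (p : integralClosure ℤ_[p] (PadicAlgCl p)) ∣ x := by
  obtain ⟨y, hy⟩ := h
  have hy1 := (isIntegral_iff_norm_le_one _).1 y.2
  have hy' : ‖(u : PadicAlgCl p) * (x : PadicAlgCl p) ^ 3‖ = ‖(p : PadicAlgCl p) * y‖ := by
    congr 1
    exact_mod_cast congrArg Subtype.val hy
  have hp1 : (p : ℝ)⁻¹ < 1 := inv_lt_one_of_one_lt₀ (by exact_mod_cast (Fact.out : p.Prime).one_lt)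
  rw [norm_mul, norm_mul, hu, one_mul, norm_pow, norm_natCast_prime] at hy'
  have hlt : ‖(x : PadicAlgCl p)‖ < 1 := by
    by_contra! h1
    have : 1 ≤ ‖(x : PadicAlgCl p)‖ ^ 3 := one_le_pow₀ h1
    have : (p : ℝ)⁻¹ * ‖(y : PadicAlgCl p)‖ ≤ (p : ℝ)⁻¹ :=
      mul_le_of_le_one_right (by positivity) hy1
    linarith
  obtain ⟨w, hw⟩ := exists_eq_prime_pow_mul_of_norm_le (n := 1)
    (by simpa using norm_le_inv_of_norm_lt_one hx hlt)
  exact ⟨w, Subtype.ext (by simpa using hw)⟩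

/-- A critical form has no zero over `ℚ_p^nr`: the values of the three dominant monomials have
pairwise distinct valuations modulo `3`. -/
theorem not_hasPoint_of_isCritical {c : Fin 10 → ℚ_[p]} (hc : IsCritical c) :
    ¬ HasPoint c (maxUnramified p) := by
  rw [hasPoint_maxUnramified_iff]
  rintro ⟨x, hx, y, hy, z, hz, hne, h⟩
  -- Scale by the coordinate of largest norm.
  obtain ⟨w, hw, hw0, hxw, hyw, hzw, hone⟩ : ∃ w ∈ maxUnramified p, w ≠ 0 ∧ ‖x‖ ≤ ‖w‖ ∧
      ‖y‖ ≤ ‖w‖ ∧ ‖z‖ ≤ ‖w‖ ∧ (w = x ∨ w = y ∨ w = z) := by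
    by_cases h1 : ‖y‖ ≤ ‖x‖ ∧ ‖z‖ ≤ ‖x‖
    · refine ⟨x, hx, ?_, le_rfl, h1.1, h1.2, Or.inl rfl⟩
      rintro rfl
      simp_all
    by_cases h2 : ‖z‖ ≤ ‖y‖
    · have hxy : ‖x‖ ≤ ‖y‖ := by
        by_contra! h3
        exact h1 ⟨h3.le, h2.trans h3.le⟩
      refine ⟨y, hy, ?_, hxy, le_rfl, h2, Or.inr (Or.inl rfl)⟩
      rintro rfl
      simp_all
    · push Not at h2
      have hxy : ‖x‖ ≤ ‖z‖ := by
        by_contra! h3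
        exact h1 ⟨(h2.trans h3).le, h3.le⟩
      refine ⟨z, hz, ?_, hxy, h2.le, le_rfl, Or.inr (Or.inr rfl)⟩
      rintro rfl
      exact (norm_nonneg y).not_gt (by simpa using h2)
  have hint : ∀ t : PadicAlgCl p, ‖t‖ ≤ ‖w‖ → IsIntegral ℤ_[p] (t / w) := by
    intro t ht
    rw [isIntegral_iff_norm_le_one, norm_div]
    exact div_le_one_of_le₀ ht (norm_nonneg _)
  have hcoef : ∀ i, ∃ b : integralClosure ℤ_[p] (PadicAlgCl p),
      algebraMap ℚ_[p] (PadicAlgCl p) (c i) = (p : PadicAlgCl p) ^ critVal i * b := by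
    intro i
    apply exists_eq_prime_pow_mul_of_norm_le
    rw [PadicAlgCl.norm_extends]
    exact (hc i).1
  choose b hb using hcoef
  have hpp : (p : ℝ) ≠ 0 := by exact_mod_cast (Fact.out : p.Prime).ne_zero
  have hbu : ∀ i ∈ ({0, 6, 9} : Finset (Fin 10)), ‖(b i : PadicAlgCl p)‖ = 1 := by
    intro i hi
    have h1 := (hc i).2 hi
    rw [← PadicAlgCl.norm_extends, hb, norm_mul, norm_pow, norm_natCast_prime] at h1
    exact mul_left_cancel₀ (pow_ne_zero _ (inv_ne_zero hpp)) (by rw [h1, mul_one])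
  obtain ⟨X, hX⟩ : ∃ X : integralClosure ℤ_[p] (PadicAlgCl p), (X : PadicAlgCl p) = x / w :=
    ⟨⟨_, hint x hxw⟩, rfl⟩
  obtain ⟨Y, hY⟩ : ∃ Y : integralClosure ℤ_[p] (PadicAlgCl p), (Y : PadicAlgCl p) = y / w :=
    ⟨⟨_, hint y hyw⟩, rfl⟩
  obtain ⟨Z, hZ⟩ : ∃ Z : integralClosure ℤ_[p] (PadicAlgCl p), (Z : PadicAlgCl p) = z / w :=
    ⟨⟨_, hint z hzw⟩, rfl⟩
  have heq : cubicEval (fun i => (p : integralClosure ℤ_[p] (PadicAlgCl p)) ^ critVal i * b i)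
      X Y Z = 0 := by
    apply Subtype.ext
    have h1 := map_cubicEval (algebraMap (integralClosure ℤ_[p] (PadicAlgCl p)) (PadicAlgCl p))
      (fun i => (p : integralClosure ℤ_[p] (PadicAlgCl p)) ^ critVal i * b i) X Y Z
    have h2 : (fun i => algebraMap (integralClosure ℤ_[p] (PadicAlgCl p)) (PadicAlgCl p)
        ((p : integralClosure ℤ_[p] (PadicAlgCl p)) ^ critVal i * b i))
        = fun i => algebraMap ℚ_[p] (PadicAlgCl p) (c i) := by
      funext i
      rw [hb, map_mul, map_pow, map_natCast]; rfl
    rw [h2] at h1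
    refine h1.trans ?_
    change cubicEval _ (X : PadicAlgCl p) (Y : PadicAlgCl p) (Z : PadicAlgCl p) = 0
    rw [hX, hY, hZ]
    have h3 : cubicEval (fun i => algebraMap ℚ_[p] (PadicAlgCl p) (c i)) (x / w) (y / w) (z / w)
        = cubicEval (fun i => algebraMap ℚ_[p] (PadicAlgCl p) (c i)) x y z / w ^ 3 := by
      simp only [cubicEval]; field_simp
    rw [h3, h, zero_div]
  have hP0 : (p : integralClosure ℤ_[p] (PadicAlgCl p)) ≠ 0 := by
    exact_mod_cast (Fact.out : p.Prime).ne_zero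
  simp only [cubicEval, critVal, Matrix.cons_val] at heq
  set P : integralClosure ℤ_[p] (PadicAlgCl p) := (p : integralClosure ℤ_[p] (PadicAlgCl p))
    with hPdef
  obtain ⟨X', rfl⟩ : P ∣ X := by
    refine prime_dvd_of_dvd_mul_cube (u := b 0) (hX ▸ div_mem hx hw) (hbu 0 (by simp))
      ⟨-(b 1 * X ^ 2 * Y + b 2 * X ^ 2 * Z + b 3 * X * Y ^ 2 + b 4 * X * Y * Z
        + P * b 5 * X * Z ^ 2 + b 6 * Y ^ 3 + P * b 7 * Y ^ 2 * Z + P * b 8 * Y * Z ^ 2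
        + P * b 9 * Z ^ 3), ?_⟩
    linear_combination heq
  obtain ⟨Y', rfl⟩ : P ∣ Y := by
    refine prime_dvd_of_dvd_mul_cube (u := b 6) (hY ▸ div_mem hy hw) (hbu 6 (by simp))
      ⟨-(P * b 0 * X' ^ 3 + P * b 1 * X' ^ 2 * Y + P * b 2 * X' ^ 2 * Z + b 3 * X' * Y ^ 2
        + b 4 * X' * Y * Z + P * b 5 * X' * Z ^ 2 + b 7 * Y ^ 2 * Z + b 8 * Y * Z ^ 2
        + b 9 * Z ^ 3), mul_left_cancel₀ hP0 ?_⟩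
    linear_combination heq
  obtain ⟨Z', rfl⟩ : P ∣ Z := by
    refine prime_dvd_of_dvd_mul_cube (u := b 9) (hZ ▸ div_mem hz hw) (hbu 9 (by simp))
      ⟨-(b 0 * X' ^ 3 + P * b 1 * X' ^ 2 * Y' + b 2 * X' ^ 2 * Z + P * b 3 * X' * Y' ^ 2
        + b 4 * X' * Y' * Z + b 5 * X' * Z ^ 2 + P * b 6 * Y' ^ 3 + P * b 7 * Y' ^ 2 * Z
        + b 8 * Y' * Z ^ 2), mul_left_cancel₀ (pow_ne_zero 2 hP0) ?_⟩
    linear_combination heq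
  have hno : ∀ t : integralClosure ℤ_[p] (PadicAlgCl p),
      ((P * t : integralClosure ℤ_[p] (PadicAlgCl p)) : PadicAlgCl p) ≠ w / w := by
    intro t ht
    rw [div_self hw0] at ht
    have h1 := congrArg norm ht
    have hP : ((P * t : integralClosure ℤ_[p] (PadicAlgCl p)) : PadicAlgCl p)
        = (p : PadicAlgCl p) * t := by simp [hPdef]
    rw [hP, norm_mul, norm_natCast_prime, norm_one] at h1
    have ht1 := (isIntegral_iff_norm_le_one _).1 t.2
    have hp1 : (p : ℝ)⁻¹ < 1 :=
      inv_lt_one_of_one_lt₀ (by exact_mod_cast (Fact.out : p.Prime).one_lt)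
    have : (p : ℝ)⁻¹ * ‖(t : PadicAlgCl p)‖ ≤ (p : ℝ)⁻¹ :=
      mul_le_of_le_one_right (by positivity) ht1
    linarith
  rcases hone with rfl | rfl | rfl
  · exact hno _ hX
  · exact hno _ hY
  · exact hno _ hZ

end Points

/-! ### Changes of variables -/

section Moves

variable {R : Type*}

/-- The coefficient vector of `c(Y, X, Z)`. -/
def swapXY (c : Fin 10 → R) : Fin 10 → R := ![c 6, c 3, c 7, c 1, c 4, c 8, c 0, c 2, c 5, c 9]

/-- The coefficient vector of `c(X, Z, Y)`. -/
def swapYZ (c : Fin 10 → R) : Fin 10 → R := ![c 0, c 2, c 1, c 5, c 4, c 3, c 9, c 8, c 7, c 6]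

lemma swapXY_swapXY (c : Fin 10 → R) : swapXY (swapXY c) = c := by
  apply funext_fin10 <;> rfl

lemma swapYZ_swapYZ (c : Fin 10 → R) : swapYZ (swapYZ c) = c := by
  apply funext_fin10 <;> rfl

variable [CommRing R]

/-- The coefficient vector of `c(X + uY + vZ, Y, Z)`. -/
def shearX (u v : R) (c : Fin 10 → R) : Fin 10 → R :=
  ![c 0,
    3 * u * c 0 + c 1,
    3 * v * c 0 + c 2,
    3 * u ^ 2 * c 0 + 2 * u * c 1 + c 3,
    6 * u * v * c 0 + 2 * v * c 1 + 2 * u * c 2 + c 4,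
    3 * v ^ 2 * c 0 + 2 * v * c 2 + c 5,
    u ^ 3 * c 0 + u ^ 2 * c 1 + u * c 3 + c 6,
    3 * u ^ 2 * v * c 0 + 2 * u * v * c 1 + u ^ 2 * c 2 + v * c 3 + u * c 4 + c 7,
    3 * u * v ^ 2 * c 0 + v ^ 2 * c 1 + 2 * u * v * c 2 + v * c 4 + u * c 5 + c 8,
    v ^ 3 * c 0 + v ^ 2 * c 2 + v * c 5 + c 9]

/-- The coefficient vector of `c(X, Y + uZ, Z)`. -/
def shearY (u : R) (c : Fin 10 → R) : Fin 10 → R :=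
  ![c 0,
    c 1,
    u * c 1 + c 2,
    c 3,
    2 * u * c 3 + c 4,
    u ^ 2 * c 3 + u * c 4 + c 5,
    c 6,
    3 * u * c 6 + c 7,
    3 * u ^ 2 * c 6 + 2 * u * c 7 + c 8,
    u ^ 3 * c 6 + u ^ 2 * c 7 + u * c 8 + c 9]

/-- The coefficient vector of `c(πX, Y, Z)`. -/
def scaleX (π : R) (c : Fin 10 → R) : Fin 10 → R :=
  ![π ^ 3 * c 0, π ^ 2 * c 1, π ^ 2 * c 2, π * c 3, π * c 4, π * c 5, c 6, c 7, c 8, c 9]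

lemma shearX_shearX (u v u' v' : R) (c : Fin 10 → R) :
    shearX u v (shearX u' v' c) = shearX (u + u') (v + v') c := by
  apply funext_fin10 <;> simp only [shearX, Matrix.cons_val] <;> ring

lemma shearY_shearY (u u' : R) (c : Fin 10 → R) :
    shearY u (shearY u' c) = shearY (u + u') c := by
  apply funext_fin10 <;> simp only [shearY, Matrix.cons_val] <;> ring

lemma scaleX_scaleX (π π' : R) (c : Fin 10 → R) :
    scaleX π (scaleX π' c) = scaleX (π * π') c := by
  apply funext_fin10 <;> simp only [scaleX, Matrix.cons_val] <;> ring

lemma shearX_zero (c : Fin 10 → R) : shearX 0 0 c = c := by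
  apply funext_fin10 <;> simp [shearX]

lemma shearY_zero (c : Fin 10 → R) : shearY 0 c = c := by
  apply funext_fin10 <;> simp [shearY]

lemma scaleX_one (c : Fin 10 → R) : scaleX 1 c = c := by
  apply funext_fin10 <;> simp [scaleX]

lemma shearX_neg_shearX (u v : R) (c : Fin 10 → R) : shearX (-u) (-v) (shearX u v c) = c := by
  rw [shearX_shearX, neg_add_cancel, neg_add_cancel, shearX_zero]

lemma shearX_shearX_neg (u v : R) (c : Fin 10 → R) : shearX u v (shearX (-u) (-v) c) = c := by
  rw [shearX_shearX, add_neg_cancel, add_neg_cancel, shearX_zero]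

lemma shearY_neg_shearY (u : R) (c : Fin 10 → R) : shearY (-u) (shearY u c) = c := by
  rw [shearY_shearY, neg_add_cancel, shearY_zero]

lemma shearY_shearY_neg (u : R) (c : Fin 10 → R) : shearY u (shearY (-u) c) = c := by
  rw [shearY_shearY, add_neg_cancel, shearY_zero]

lemma cubicEval_swapXY (c : Fin 10 → R) (x y z : R) :
    cubicEval (swapXY c) x y z = cubicEval c y x z := by
  simp only [cubicEval, swapXY, Matrix.cons_val]; ring

lemma cubicEval_swapYZ (c : Fin 10 → R) (x y z : R) :
    cubicEval (swapYZ c) x y z = cubicEval c x z y := by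
  simp only [cubicEval, swapYZ, Matrix.cons_val]; ring

lemma cubicEval_shearX (u v : R) (c : Fin 10 → R) (x y z : R) :
    cubicEval (shearX u v c) x y z = cubicEval c (x + u * y + v * z) y z := by
  simp only [cubicEval, shearX, Matrix.cons_val]; ring

lemma cubicEval_shearY (u : R) (c : Fin 10 → R) (x y z : R) :
    cubicEval (shearY u c) x y z = cubicEval c x (y + u * z) z := by
  simp only [cubicEval, shearY, Matrix.cons_val]; ring

lemma cubicEval_scaleX (π : R) (c : Fin 10 → R) (x y z : R) :
    cubicEval (scaleX π c) x y z = cubicEval c (π * x) y z := by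
  simp only [cubicEval, scaleX, Matrix.cons_val]; ring

lemma cubicEval_smul (π : R) (c : Fin 10 → R) (x y z : R) :
    cubicEval (π • c) x y z = π * cubicEval c x y z := by
  simp only [cubicEval, Pi.smul_apply, smul_eq_mul]; ring

variable {S : Type*} [CommRing S] (f : R →+* S)

lemma map_swapXY (c : Fin 10 → R) : f ∘ swapXY c = swapXY (f ∘ c) := by
  apply funext_fin10 <;> rfl

lemma map_swapYZ (c : Fin 10 → R) : f ∘ swapYZ c = swapYZ (f ∘ c) := by
  apply funext_fin10 <;> rfl

lemma map_shearX (u v : R) (c : Fin 10 → R) :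
    f ∘ shearX u v c = shearX (f u) (f v) (f ∘ c) := by
  apply funext_fin10 <;> simp [shearX, map_ofNat]

lemma map_shearY (u : R) (c : Fin 10 → R) : f ∘ shearY u c = shearY (f u) (f ∘ c) := by
  apply funext_fin10 <;> simp [shearY, map_ofNat]

lemma map_scaleX (π : R) (c : Fin 10 → R) : f ∘ scaleX π c = scaleX (f π) (f ∘ c) := by
  apply funext_fin10 <;> simp [scaleX]

lemma map_smul_coeff (π : R) (c : Fin 10 → R) : f ∘ (π • c) = f π • (f ∘ c) := by
  funext i; simp

end Moves

/-- A property of cubic forms over a field is stable if it is preserved by the changes of variables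
generating the general linear group and by nonzero scalars. -/
structure IsStable {F : Type*} [Field F] (I : (Fin 10 → F) → Prop) : Prop where
  swapXY : ∀ {c}, I c → I (swapXY c)
  swapYZ : ∀ {c}, I c → I (swapYZ c)
  shearX : ∀ {c} (u v), I c → I (shearX u v c)
  shearY : ∀ {c} (u), I c → I (shearY u c)
  scaleX : ∀ {c} {π : F}, π ≠ 0 → I c → I (scaleX π c)
  smul : ∀ {c} {π : F}, π ≠ 0 → I c → I (π • c)

/-- Insolubility over an extension field is stable. -/
lemma isStable_not_hasPoint {F K : Type*} [Field F] [Field K] [Algebra F K] :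
    IsStable fun c : Fin 10 → F => ¬ HasPoint c K := by
  have key : ∀ c : Fin 10 → F, HasPoint c K ↔ ∃ x y z : K, (x ≠ 0 ∨ y ≠ 0 ∨ z ≠ 0) ∧
      cubicEval (algebraMap F K ∘ c) x y z = 0 := fun c => hasPoint_iff c
  have hne : ∀ {x y z t : K}, (x ≠ 0 ∨ y ≠ 0 ∨ z ≠ 0) → (y = 0 → z = 0 → x ≠ 0 → t ≠ 0) →
      (t ≠ 0 ∨ y ≠ 0 ∨ z ≠ 0) := by
    intro x y z t h h'
    by_cases hy : y = 0
    · by_cases hz : z = 0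
      · simp_all
      · exact Or.inr (Or.inr hz)
    · exact Or.inr (Or.inl hy)
  simp only [key]
  refine ⟨?_, ?_, ?_, ?_, ?_, ?_⟩
  · rintro c h ⟨x, y, z, h0, he⟩
    rw [map_swapXY, cubicEval_swapXY] at he
    exact h ⟨y, x, z, by tauto, he⟩
  · rintro c h ⟨x, y, z, h0, he⟩
    rw [map_swapYZ, cubicEval_swapYZ] at he
    exact h ⟨x, z, y, by tauto, he⟩
  · rintro c u v h ⟨x, y, z, h0, he⟩
    rw [map_shearX, cubicEval_shearX] at he
    refine h ⟨_, y, z, hne h0 ?_, he⟩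
    rintro rfl rfl hx
    simpa using hx
  · rintro c u h ⟨x, y, z, h0, he⟩
    rw [map_shearY, cubicEval_shearY] at he
    refine h ⟨x, _, z, ?_, he⟩
    by_cases hz : z = 0
    · subst hz; simpa using h0
    · exact Or.inr (Or.inr hz)
  · rintro c π hπ h ⟨x, y, z, h0, he⟩
    rw [map_scaleX, cubicEval_scaleX] at he
    exact h ⟨_, y, z, hne h0 fun _ _ hx => mul_ne_zero ((map_ne_zero _).2 hπ) hx, he⟩
  · rintro c π hπ h ⟨x, y, z, h0, he⟩
    rw [map_smul_coeff, cubicEval_smul] at he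
    exact h ⟨x, y, z, h0, (mul_eq_zero.1 he).resolve_left ((map_ne_zero _).2 hπ)⟩

section Saturation

variable {p : ℕ} [Fact p.Prime]

/-- The smallest stable property containing the critical forms. -/
inductive Saturated : (Fin 10 → ℚ_[p]) → Prop
  | critical (c) : IsCritical c → Saturated c
  | swapXY (c) : Saturated c → Saturated (swapXY c)
  | swapYZ (c) : Saturated c → Saturated (swapYZ c)
  | shearX (c u v) : Saturated c → Saturated (shearX u v c)
  | shearY (c u) : Saturated c → Saturated (shearY u c)
  | scaleX (c) (π : ℚ_[p]) : π ≠ 0 → Saturated c → Saturated (scaleX π c)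
  | smul (c) (π : ℚ_[p]) : π ≠ 0 → Saturated c → Saturated (π • c)

lemma isStable_saturated : IsStable (Saturated (p := p)) where
  swapXY := .swapXY _
  swapYZ := .swapYZ _
  shearX u v := .shearX _ u v
  shearY u := .shearY _ u
  scaleX h := .scaleX _ _ h
  smul h := .smul _ _ h

lemma Saturated.of_isStable {I : (Fin 10 → ℚ_[p]) → Prop} (hI : IsStable I)
    (hcrit : ∀ c, IsCritical c → I c) {c : Fin 10 → ℚ_[p]} (hc : Saturated c) : I c := by
  induction hc with
  | critical c h => exact hcrit c h
  | swapXY c _ ih => exact hI.swapXY ih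
  | swapYZ c _ ih => exact hI.swapYZ ih
  | shearX c u v _ ih => exact hI.shearX u v ih
  | shearY c u _ ih => exact hI.shearY u ih
  | scaleX c π h _ ih => exact hI.scaleX h ih
  | smul c π h _ ih => exact hI.smul h ih

lemma isOpen_isCritical : IsOpen {c : Fin 10 → ℚ_[p] | IsCritical c} := by
  have hp : (p : ℝ) ≠ 0 := by exact_mod_cast (Fact.out : p.Prime).ne_zero
  have : {c : Fin 10 → ℚ_[p] | IsCritical c} = ⋂ i, (fun c : Fin 10 → ℚ_[p] => c i) ⁻¹'
      {x | ‖x‖ ≤ ((p : ℝ)⁻¹) ^ critVal i ∧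
        (i ∈ ({0, 6, 9} : Finset (Fin 10)) → ‖x‖ = ((p : ℝ)⁻¹) ^ critVal i)} := by
    ext c; simp only [Set.mem_iInter]; rfl
  rw [this]
  refine isOpen_iInter_of_finite fun i => IsOpen.preimage (continuous_apply i) ?_
  have hpos : ((p : ℝ)⁻¹) ^ critVal i ≠ 0 := pow_ne_zero _ (inv_ne_zero hp)
  have h1 := IsUltrametricDist.isOpen_closedBall (0 : ℚ_[p]) hpos
  have h2 := IsUltrametricDist.isOpen_sphere (0 : ℚ_[p]) hpos
  by_cases hi : i ∈ ({0, 6, 9} : Finset (Fin 10))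
  · convert h2 using 1
    ext x
    simp only [Set.mem_ofPred_eq, mem_sphere_zero_iff_norm, hi, forall_const]
    exact ⟨fun h => h.2, fun h => ⟨h.le, h⟩⟩
  · convert h1 using 1
    ext x
    simp [hi]

/-- The saturation of the critical forms is open, since the changes of variables are
homeomorphisms of the space of forms. -/
lemma isOpen_saturated : IsOpen {c : Fin 10 → ℚ_[p] | Saturated c} := by
  rw [isOpen_iff_mem_nhds]
  intro c hc
  have key : ∀ (f g : (Fin 10 → ℚ_[p]) → Fin 10 → ℚ_[p]) (c : Fin 10 → ℚ_[p]),
      Continuous g → (∀ d, f (g d) = d) → (∀ d, g (f d) = d) →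
      (∀ d, Saturated d → Saturated (f d)) → {d | Saturated d} ∈ nhds c →
      {d | Saturated d} ∈ nhds (f c) := by
    intro f g c hg hfg hgf hS h
    have h1 : {d | Saturated d} ∈ nhds (g (f c)) := by rwa [hgf]
    refine Filter.mem_of_superset (hg.continuousAt.preimage_mem_nhds h1) fun d hd => ?_
    have := hS _ hd
    rwa [hfg] at this
  induction hc with
  | critical c h =>
    exact Filter.mem_of_superset (isOpen_isCritical.mem_nhds h) fun d hd => .critical d hd
  | swapXY c _ ih =>
    refine key swapXY swapXY c ?_ swapXY_swapXY swapXY_swapXY (fun d => .swapXY d) ih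
    unfold swapXY; fun_prop
  | swapYZ c _ ih =>
    refine key swapYZ swapYZ c ?_ swapYZ_swapYZ swapYZ_swapYZ (fun d => .swapYZ d) ih
    unfold swapYZ; fun_prop
  | shearX c u v _ ih =>
    refine key (shearX u v) (shearX (-u) (-v)) c ?_ (shearX_shearX_neg u v)
      (shearX_neg_shearX u v) (fun d => .shearX d u v) ih
    unfold shearX; fun_prop
  | shearY c u _ ih =>
    refine key (shearY u) (shearY (-u)) c ?_ (shearY_shearY_neg u)
      (shearY_neg_shearY u) (fun d => .shearY d u) ih
    unfold shearY; fun_prop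
  | scaleX c π h _ ih =>
    refine key (scaleX π) (scaleX π⁻¹) c ?_ (fun d => ?_) (fun d => ?_)
      (fun d => .scaleX d π h) ih
    · unfold scaleX; fun_prop
    · rw [scaleX_scaleX, mul_inv_cancel₀ h, scaleX_one]
    · rw [scaleX_scaleX, inv_mul_cancel₀ h, scaleX_one]
  | smul c π h _ ih =>
    exact key (π • ·) (π⁻¹ • ·) c (by fun_prop) (smul_inv_smul₀ h) (inv_smul_smul₀ h)
      (fun d => .smul d π h) ih

end Saturation

/-! ### Boxes of cubic forms and their measure -/

section Boxes

variable {p : ℕ} [Fact p.Prime]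

instance : (padicMeasure p).IsAddHaarMeasure := by
  unfold padicMeasure; infer_instance

instance : (cubicMeasure p).IsAddHaarMeasure := by
  unfold cubicMeasure; infer_instance

instance : IsProbabilityMeasure (cubicMeasure p) := by
  unfold cubicMeasure; infer_instance

/-- The diagonal map multiplying the `i`-th coefficient by `p ^ w i`. -/
def scale (w : Fin 10 → ℕ) : (Fin 10 → ℤ_[p]) →+ (Fin 10 → ℤ_[p]) where
  toFun c i := (p : ℤ_[p]) ^ w i * c i
  map_zero' := by funext i; simp
  map_add' c d := by funext i; simp [mul_add]

lemma scale_apply (w : Fin 10 → ℕ) (c : Fin 10 → ℤ_[p]) (i : Fin 10) :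
    scale w c i = (p : ℤ_[p]) ^ w i * c i := rfl

lemma scale_scale (w w' : Fin 10 → ℕ) (c : Fin 10 → ℤ_[p]) :
    scale w (scale w' c) = scale (w + w') c := by
  funext i
  simp only [scale_apply, Pi.add_apply, pow_add]
  ring

lemma prime_ne_zero : (p : ℤ_[p]) ≠ 0 := by
  exact_mod_cast (Fact.out : p.Prime).ne_zero

lemma scale_injective (w : Fin 10 → ℕ) : Function.Injective (scale (p := p) w) := by
  intro c d h
  funext i
  exact mul_left_cancel₀ (pow_ne_zero (w i) prime_ne_zero) (congrFun h i)

lemma continuous_scale (w : Fin 10 → ℕ) : Continuous (scale (p := p) w) :=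
  continuous_pi fun i => continuous_const.mul (continuous_apply i)

lemma mem_range_scale_single (i : Fin 10) (c : Fin 10 → ℤ_[p]) :
    c ∈ Set.range (scale (p := p) (Pi.single i 1)) ↔ PadicInt.toZMod (c i) = 0 := by
  rw [toZMod_eq_zero_iff]
  constructor
  · rintro ⟨d, rfl⟩
    simp [scale_apply]
  · rintro ⟨x, hx⟩
    refine ⟨Function.update c i x, ?_⟩
    funext j
    by_cases hj : j = i
    · subst hj; simp [scale_apply, hx]
    · simp [scale_apply, hj]

lemma measure_scale_single_image (i : Fin 10) (E : Set (Fin 10 → ℤ_[p])) :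
    cubicMeasure p (scale (Pi.single i 1) '' E) = (p : ENNReal)⁻¹ * cubicMeasure p E := by
  let φ : (Fin 10 → ℤ_[p]) →+ ZMod p :=
    (PadicInt.toZMod (p := p)).toAddMonoidHom.comp (Pi.evalAddMonoidHom _ i)
  have hφ : Function.Surjective φ := fun x => by
    obtain ⟨a, ha⟩ := toZMod_surjective x
    exact ⟨fun _ => a, ha⟩
  have hrange : Set.range (scale (p := p) (Pi.single i 1)) = (φ.ker : Set (Fin 10 → ℤ_[p])) := by
    ext c; exact mem_range_scale_single i c
  have hclosed : IsClosed (Set.range (scale (p := p) (Pi.single i 1))) :=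
    (isCompact_range (continuous_scale _)).isClosed
  have hindex : φ.ker.index = p := by
    rw [AddSubgroup.index_ker, AddMonoidHom.range_eq_top.2 hφ, AddSubgroup.card_top, Nat.card_zmod]
  have hfi : φ.ker.FiniteIndex := ⟨by rw [hindex]; exact (Fact.out : p.Prime).ne_zero⟩
  have hopen : IsOpen (Set.range (scale (p := p) (Pi.single i 1))) := by
    rw [hrange]
    exact AddSubgroup.isOpen_of_isClosed_of_finiteIndex _ (hrange ▸ hclosed)
  have hemb : Topology.IsOpenEmbedding (scale (p := p) (Pi.single i 1)) :=
    ⟨((continuous_scale _).isClosedEmbedding (scale_injective _)).isEmbedding, hopen⟩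
  have hH : ((cubicMeasure p).comap (scale (Pi.single i 1))).IsAddHaarMeasure :=
    Measure.IsAddHaarMeasure.comap (mH := inferInstance) _ hemb
  have huniq := Measure.isAddInvariant_eq_smul_of_compactSpace
    ((cubicMeasure p).comap (scale (Pi.single i 1))) (cubicMeasure p)
  set k := Measure.addHaarScalarFactor ((cubicMeasure p).comap (scale (Pi.single i 1)))
    (cubicMeasure p) with hk
  have happ : ∀ E : Set (Fin 10 → ℤ_[p]),
      cubicMeasure p (scale (Pi.single i 1) '' E) = k * cubicMeasure p E := by
    intro E
    rw [← hemb.measurableEmbedding.comap_apply, huniq]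
    rfl
  have hk' : (k : ENNReal) = (p : ENNReal)⁻¹ := by
    have h1 := happ Set.univ
    rw [Set.image_univ, measure_univ, mul_one, hrange] at h1
    have h2 := AddSubgroup.index_mul_measure φ.ker (hrange ▸ hclosed.measurableSet)
      (cubicMeasure p)
    rw [hindex, measure_univ, h1] at h2
    exact ENNReal.eq_inv_of_mul_eq_one_left (by rw [mul_comm]; exact h2)
  rw [happ, hk']

lemma measure_scale_image (w : Fin 10 → ℕ) (E : Set (Fin 10 → ℤ_[p])) :
    cubicMeasure p (scale w '' E) = (p : ENNReal)⁻¹ ^ (∑ i, w i) * cubicMeasure p E := by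
  induction h : ∑ i, w i generalizing w with
  | zero =>
    have hw : w = 0 := by
      funext i
      simpa using (Finset.sum_eq_zero_iff.1 h) i (Finset.mem_univ i)
    have : (scale (p := p) w : (Fin 10 → ℤ_[p]) → _) = id := by
      funext c i; simp [scale_apply, hw]
    rw [this]; simp
  | succ n ih =>
    obtain ⟨i, hi⟩ : ∃ i, w i ≠ 0 := by
      by_contra! h0
      simp [h0] at h
    obtain ⟨v, rfl⟩ : ∃ v : Fin 10 → ℕ, w = Pi.single i 1 + v := by
      refine ⟨fun j => if j = i then w j - 1 else w j, ?_⟩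
      funext j
      by_cases hj : j = i
      · subst hj; simp; omega
      · simp [hj]
    have hs : ∑ j, v j = n := by
      have h1 : ∑ j, (Pi.single i 1 : Fin 10 → ℕ) j = 1 := by simp
      simp only [Pi.add_apply, Finset.sum_add_distrib, h1] at h
      omega
    have himg : scale (p := p) (Pi.single i 1 + v) '' E
        = scale (Pi.single i 1) '' (scale v '' E) := by
      rw [Set.image_image]
      simp only [scale_scale]
    rw [himg, measure_scale_single_image, ih _ hs, pow_succ]
    ring

lemma real_measure_scale_image (w : Fin 10 → ℕ) (E : Set (Fin 10 → ℤ_[p])) :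
    (cubicMeasure p).real (scale w '' E) = ((p : ℝ)⁻¹) ^ (∑ i, w i) * (cubicMeasure p).real E := by
  simp [measureReal_def, measure_scale_image]

variable (p) in
/-- The set of forms whose `i`-th coefficient is divisible by `p ^ n i`, and by no higher power of
`p` if `i ∈ U`. The coefficients `0, …, 9` belong to the monomials
`X³, X²Y, X²Z, XY², XYZ, XZ², Y³, Y²Z, YZ², Z³`. -/
def box (n : Fin 10 → ℕ) (U : Finset (Fin 10)) : Set (Fin 10 → ℤ_[p]) :=
  {c | ∀ i, (p : ℤ_[p]) ^ n i ∣ c i ∧ (i ∈ U → ¬ (p : ℤ_[p]) ^ (n i + 1) ∣ c i)}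

lemma prime_pow_dvd_iff (n : ℕ) (x : ℤ_[p]) :
    (p : ℤ_[p]) ^ n ∣ x ↔ ‖x‖ ≤ ((p : ℝ)⁻¹) ^ n := by
  rw [← Ideal.mem_span_singleton, ← PadicInt.norm_le_pow_iff_mem_span_pow]
  simp [zpow_neg, inv_pow]

lemma measurableSet_dvd (n : ℕ) : MeasurableSet {x : ℤ_[p] | (p : ℤ_[p]) ^ n ∣ x} := by
  simp only [prime_pow_dvd_iff]
  exact (isClosed_le continuous_norm continuous_const).measurableSet

lemma measurableSet_box (n : Fin 10 → ℕ) (U : Finset (Fin 10)) : MeasurableSet (box p n U) := by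
  have : box p n U = ⋂ i, (fun c : Fin 10 → ℤ_[p] => c i) ⁻¹'
      {x | (p : ℤ_[p]) ^ n i ∣ x ∧ (i ∈ U → ¬ (p : ℤ_[p]) ^ (n i + 1) ∣ x)} := by
    ext c; simp only [Set.mem_iInter]; rfl
  rw [this]
  refine MeasurableSet.iInter fun i => measurable_pi_apply i ?_
  by_cases hi : i ∈ U
  · convert (measurableSet_dvd (p := p) (n i)).inter (measurableSet_dvd (n i + 1)).compl using 1
    ext x; simp [hi]
  · convert measurableSet_dvd (p := p) (n i) using 1
    ext x; simp [hi]

lemma image_scale_box (w n : Fin 10 → ℕ) (U : Finset (Fin 10)) :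
    scale w '' box p n U = box p (n + w) U := by
  have hdvd : ∀ (c : Fin 10 → ℤ_[p]) i k,
      (p : ℤ_[p]) ^ (k + w i) ∣ scale w c i ↔ (p : ℤ_[p]) ^ k ∣ c i := by
    intro c i k
    rw [scale_apply, pow_add, mul_comm]
    exact mul_dvd_mul_iff_left (pow_ne_zero _ prime_ne_zero)
  have hmem : ∀ c, scale w c ∈ box p (n + w) U ↔ c ∈ box p n U := by
    intro c
    refine forall_congr' fun i => ?_
    rw [Pi.add_apply, hdvd, show n i + w i + 1 = n i + 1 + w i by ring, hdvd]
  ext c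
  constructor
  · rintro ⟨d, hd, rfl⟩
    exact (hmem d).2 hd
  · intro hc
    have : ∀ i, ∃ x, c i = (p : ℤ_[p]) ^ w i * x := fun i =>
      (pow_dvd_pow _ (Nat.le_add_left (w i) (n i))).trans (hc i).1
    choose d hd using this
    have hcd : scale w d = c := funext fun i => (hd i).symm
    exact ⟨d, (hmem d).1 (hcd ▸ hc), hcd⟩

/-- The measure of the forms of a set `A` lying in a box. -/
def vol (A : Set (Fin 10 → ℤ_[p])) (n : Fin 10 → ℕ) (U : Finset (Fin 10)) : ℝ :=
  (cubicMeasure p).real (A ∩ box p n U)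

lemma vol_split (A : Set (Fin 10 → ℤ_[p])) {n n' : Fin 10 → ℕ} {U : Finset (Fin 10)} (i : Fin 10)
    (hi : i ∉ U) (hn : ∀ j, n' j = if j = i then n j + 1 else n j) :
    vol A n U = vol A n (insert i U) + vol A n' U := by
  have h1 : A ∩ box p n U ∩ box p n' U = A ∩ box p n' U := by
    rw [Set.inter_assoc]
    congr 1
    refine Set.inter_eq_right.2 fun c hc j => ?_
    have hj := hc j
    rw [hn] at hj
    split_ifs at hj with h
    · subst h
      exact ⟨(pow_dvd_pow _ (Nat.le_succ _)).trans hj.1, fun h => absurd h hi⟩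
    · exact hj
  have h2 : (A ∩ box p n U) \ box p n' U = A ∩ box p n (insert i U) := by
    ext c
    constructor
    · rintro ⟨⟨hA, hc⟩, hc'⟩
      refine ⟨hA, fun j => ⟨(hc j).1, fun hj => ?_⟩⟩
      rcases Finset.mem_insert.1 hj with rfl | hj
      · intro hd
        apply hc'
        intro l
        rw [hn]
        split_ifs with h
        · subst h; exact ⟨hd, fun h => absurd h hi⟩
        · exact hc l
      · exact (hc j).2 hj
    · rintro ⟨hA, hc⟩
      refine ⟨⟨hA, fun j => ⟨(hc j).1, fun hj => (hc j).2 (Finset.mem_insert_of_mem hj)⟩⟩, ?_⟩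
      intro hc'
      have := (hc' i).1
      rw [hn, if_pos rfl] at this
      exact (hc i).2 (Finset.mem_insert_self _ _) this
  have := measureReal_inter_add_sdiff (μ := cubicMeasure p) (s := A ∩ box p n U)
    (measurableSet_box n' U)
  rw [h1, h2] at this
  unfold vol
  linarith

lemma vol_restrict (A : Set (Fin 10 → ℤ_[p])) {n n' : Fin 10 → ℕ} {U : Finset (Fin 10)}
    (hn : ∀ i, n i ≤ n' i ∧ (i ∈ U → n i = n' i))
    (h : ∀ c ∈ A, c ∈ box p n U → ∀ i, (p : ℤ_[p]) ^ n' i ∣ c i) : vol A n U = vol A n' U := by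
  unfold vol
  congr 1
  ext c
  refine and_congr_right fun hA => ⟨fun hc i => ⟨h c hA hc i, fun hi => ?_⟩, fun hc i =>
    ⟨(pow_dvd_pow _ (hn i).1).trans (hc i).1, fun hi => ?_⟩⟩
  · rw [← (hn i).2 hi]; exact (hc i).2 hi
  · rw [(hn i).2 hi]; exact (hc i).2 hi

lemma vol_add_scale {A : Set (Fin 10 → ℤ_[p])} {w : Fin 10 → ℕ} (hA : ∀ c, scale w c ∈ A ↔ c ∈ A)
    (n : Fin 10 → ℕ) (U : Finset (Fin 10)) :
    vol A (n + w) U = ((p : ℝ)⁻¹) ^ (∑ i, w i) * vol A n U := by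
  unfold vol
  rw [← real_measure_scale_image, ← image_scale_box]
  congr 1
  ext c
  constructor
  · rintro ⟨h1, d, hd, rfl⟩
    exact ⟨d, ⟨(hA d).1 h1, hd⟩, rfl⟩
  · rintro ⟨d, ⟨h1, hd⟩, rfl⟩
    exact ⟨(hA d).2 h1, d, hd, rfl⟩

/-- The measure of a box with prescribed exact valuations at the coefficients of `X³`, `Y³` and
`Z³`. -/
lemma vol_univ_box (n : Fin 10 → ℕ) : vol (p := p) Set.univ n {0, 6, 9}
    = ((p : ℝ)⁻¹) ^ (∑ i, n i) * (1 - (p : ℝ)⁻¹) ^ 3 := by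
  have hstep : ∀ (i : Fin 10) (U : Finset (Fin 10)), i ∉ U →
      vol (p := p) Set.univ 0 (insert i U) = (1 - (p : ℝ)⁻¹) * vol (p := p) Set.univ 0 U := by
    intro i U hi
    have h1 := vol_split (p := p) Set.univ (n := 0) (n' := 0 + Pi.single i 1) i hi (by
      intro j
      by_cases hj : j = i
      · subst hj; simp
      · simp [hj])
    rw [vol_add_scale (by simp)] at h1
    have h2 : ∑ j, (Pi.single i 1 : Fin 10 → ℕ) j = 1 := by simp
    rw [h2] at h1
    linear_combination -h1
  have h0 : vol (p := p) Set.univ 0 ∅ = 1 := by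
    have : box p 0 ∅ = Set.univ := by ext c; simp [box]
    simp [vol, this]
  have hn : n = 0 + n := by simp
  rw [hn, vol_add_scale (by simp), show ({0, 6, 9} : Finset (Fin 10))
    = insert 0 (insert 6 (insert 9 ∅)) from rfl, hstep _ _ (by decide), hstep _ _ (by decide),
    hstep _ _ (by decide), h0, zero_add]
  ring

/-- A continuous additive automorphism of the space of forms over `ℤ_p` preserving the set `A`. -/
structure IsSymmetry (A : Set (Fin 10 → ℤ_[p])) (f : (Fin 10 → ℤ_[p]) → Fin 10 → ℤ_[p]) :
    Prop where
  continuous : Continuous f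
  add : ∀ c d, f (c + d) = f c + f d
  bijective : Function.Bijective f
  mem_iff : ∀ c, f c ∈ A ↔ c ∈ A

lemma IsSymmetry.comp {A : Set (Fin 10 → ℤ_[p])} {f g : (Fin 10 → ℤ_[p]) → Fin 10 → ℤ_[p]}
    (hf : IsSymmetry A f) (hg : IsSymmetry A g) : IsSymmetry A (f ∘ g) where
  continuous := hf.continuous.comp hg.continuous
  add c d := by simp [hg.add, hf.add]
  bijective := hf.bijective.comp hg.bijective
  mem_iff c := (hf.mem_iff _).trans (hg.mem_iff c)

lemma IsSymmetry.measure_preimage {A : Set (Fin 10 → ℤ_[p])}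
    {f : (Fin 10 → ℤ_[p]) → Fin 10 → ℤ_[p]} (hf : IsSymmetry A f) (E : Set (Fin 10 → ℤ_[p])) :
    (cubicMeasure p).real (A ∩ f ⁻¹' E) = (cubicMeasure p).real (A ∩ E) := by
  have hmp : MeasurePreserving f (cubicMeasure p) (cubicMeasure p) :=
    AddMonoidHom.measurePreserving (f := AddMonoidHom.mk' f hf.add) hf.continuous
      hf.bijective.surjective rfl
  have hemb := (hf.continuous.isClosedEmbedding hf.bijective.injective).measurableEmbedding
  have hA : A ∩ f ⁻¹' E = f ⁻¹' (A ∩ E) := by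
    ext c
    exact and_congr_left fun _ => (hf.mem_iff c).symm
  rw [hA, measureReal_def, measureReal_def, hmp.measure_preimage_emb hemb]

/-- If the part of `E` inside `A` is partitioned into preimages of `E'` under symmetries, then its
measure is a multiple of that of `A ∩ E'`. No measurability of `A` is needed. -/
lemma measure_inter_eq_card_mul {A : Set (Fin 10 → ℤ_[p])} {ι : Type*} [Fintype ι]
    {f : ι → (Fin 10 → ℤ_[p]) → Fin 10 → ℤ_[p]} (hf : ∀ t, IsSymmetry A (f t))
    {E E' : Set (Fin 10 → ℤ_[p])} (hE' : MeasurableSet E')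
    (hcover : ∀ c ∈ A, c ∈ E ↔ ∃ t, f t c ∈ E')
    (huniq : ∀ c s t, f s c ∈ E' → f t c ∈ E' → s = t) :
    (cubicMeasure p).real (A ∩ E) = Fintype.card ι * (cubicMeasure p).real (A ∩ E') := by
  have h1 : A ∩ E = (⋃ t, f t ⁻¹' E') ∩ A := by
    ext c
    constructor
    · rintro ⟨hA, hE⟩
      exact ⟨Set.mem_iUnion.2 ((hcover c hA).1 hE), hA⟩
    · rintro ⟨hE, hA⟩
      exact ⟨hA, (hcover c hA).2 (Set.mem_iUnion.1 hE)⟩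
  have hm : ∀ t, MeasurableSet (f t ⁻¹' E') := fun t => (hf t).continuous.measurable hE'
  have hd : Pairwise (Function.onFun Disjoint fun t => f t ⁻¹' E') := by
    intro s t hst
    exact Set.disjoint_left.2 fun c hs ht => hst (huniq c s t hs ht)
  rw [h1, ← measureReal_restrict_apply (MeasurableSet.iUnion hm),
    measureReal_iUnion_fintype hd hm]
  have : ∀ t, ((cubicMeasure p).restrict A).real (f t ⁻¹' E')
      = (cubicMeasure p).real (A ∩ E') := by
    intro t
    rw [measureReal_restrict_apply (hm t), Set.inter_comm, (hf t).measure_preimage]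
  simp [this]

end Boxes

/-! ### The recursion for the insoluble locus -/

section Recursion

variable {p : ℕ} [Fact p.Prime]

/-- The coefficientwise reduction modulo `p`. -/
def red (c : Fin 10 → ℤ_[p]) : Fin 10 → ZMod p := PadicInt.toZMod (p := p) ∘ c

lemma red_eq_zero_iff {c : Fin 10 → ℤ_[p]} {i : Fin 10} : red c i = 0 ↔ (p : ℤ_[p]) ∣ c i :=
  toZMod_eq_zero_iff _

/-- The properties of the set of insoluble cubics over `ℤ_p` that determine its measure: invariance
under changes of variables and multiplication by `p`, the possible reductions, and the insolubility
of the critical forms. -/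
structure IsInsolubleLocus (A : Set (Fin 10 → ℤ_[p])) : Prop where
  swapXY : ∀ c, swapXY c ∈ A ↔ c ∈ A
  swapYZ : ∀ c, swapYZ c ∈ A ↔ c ∈ A
  shearX : ∀ u v c, shearX u v c ∈ A ↔ c ∈ A
  shearY : ∀ u c, shearY u c ∈ A ↔ c ∈ A
  scaleX : ∀ c, scaleX (p : ℤ_[p]) c ∈ A ↔ c ∈ A
  smul : ∀ c, (p : ℤ_[p]) • c ∈ A ↔ c ∈ A
  reduction : ∀ c ∈ A, red c = 0 ∨ IsTripleLine (red c)
  critical : box p critVal {0, 6, 9} ⊆ A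

variable {A : Set (Fin 10 → ℤ_[p])}

namespace IsInsolubleLocus

lemma isSymmetry_swapXY (hA : IsInsolubleLocus A) : IsSymmetry A PlaneCubic.swapXY where
  continuous := by unfold PlaneCubic.swapXY; fun_prop
  add c d := by apply funext_fin10 <;> rfl
  bijective := Function.Involutive.bijective swapXY_swapXY
  mem_iff := hA.swapXY

lemma isSymmetry_swapYZ (hA : IsInsolubleLocus A) : IsSymmetry A PlaneCubic.swapYZ where
  continuous := by unfold PlaneCubic.swapYZ; fun_prop
  add c d := by apply funext_fin10 <;> rfl
  bijective := Function.Involutive.bijective swapYZ_swapYZ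
  mem_iff := hA.swapYZ

lemma isSymmetry_shearX (hA : IsInsolubleLocus A) (u v : ℤ_[p]) :
    IsSymmetry A (PlaneCubic.shearX u v) where
  continuous := by unfold PlaneCubic.shearX; fun_prop
  add c d := by
    apply funext_fin10 <;> simp only [PlaneCubic.shearX, Matrix.cons_val, Pi.add_apply] <;> ring
  bijective := Function.bijective_iff_has_inverse.2
    ⟨_, shearX_neg_shearX u v, shearX_shearX_neg u v⟩
  mem_iff := hA.shearX u v

lemma isSymmetry_shearY (hA : IsInsolubleLocus A) (u : ℤ_[p]) :
    IsSymmetry A (PlaneCubic.shearY u) where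
  continuous := by unfold PlaneCubic.shearY; fun_prop
  add c d := by
    apply funext_fin10 <;> simp only [PlaneCubic.shearY, Matrix.cons_val, Pi.add_apply] <;> ring
  bijective := Function.bijective_iff_has_inverse.2
    ⟨_, shearY_neg_shearY u, shearY_shearY_neg u⟩
  mem_iff := hA.shearY u

/-- Substituting `pX` for `X` and dividing by `p` does not change the measure: both the substitution
and the multiplication by `p` have modulus `q¹⁰`, where `q = p⁻¹`. -/
lemma vol_shiftX (hA : IsInsolubleLocus A) {n n' : Fin 10 → ℕ} (U : Finset (Fin 10))
    (h : n + ![3, 2, 2, 1, 1, 1, 0, 0, 0, 0] = n' + 1) : vol A n U = vol A n' U := by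
  have h1 := vol_add_scale (A := A) (w := ![3, 2, 2, 1, 1, 1, 0, 0, 0, 0]) (fun c => by
    rw [← hA.scaleX c]
    apply iff_of_eq; congr 1
    apply funext_fin10 <;> simp [scale_apply, PlaneCubic.scaleX]) n U
  have h2 := vol_add_scale (A := A) (w := 1) (fun c => by
    rw [← hA.smul c]
    apply iff_of_eq; congr 1
    funext i; simp [scale_apply]) n' U
  rw [h, h2] at h1
  have hp : ((p : ℝ)⁻¹) ^ 10 ≠ 0 :=
    pow_ne_zero _ (inv_ne_zero (by exact_mod_cast (Fact.out : p.Prime).ne_zero))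
  exact (mul_left_cancel₀ hp (by simpa [Fin.sum_univ_succ] using h1)).symm

/-- The analogue of `vol_shiftX` for the substitution of `pY` for `Y`. -/
lemma vol_shiftY (hA : IsInsolubleLocus A) {n n' : Fin 10 → ℕ} (U : Finset (Fin 10))
    (h : n + ![0, 1, 0, 2, 1, 0, 3, 2, 1, 0] = n' + 1) : vol A n U = vol A n' U := by
  have h1 := vol_add_scale (A := A) (w := ![0, 1, 0, 2, 1, 0, 3, 2, 1, 0]) (fun c => by
    have h : scale (p := p) ![0, 1, 0, 2, 1, 0, 3, 2, 1, 0] c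
        = PlaneCubic.swapXY (PlaneCubic.scaleX (p : ℤ_[p]) (PlaneCubic.swapXY c)) := by
      apply funext_fin10 <;> simp [scale_apply, PlaneCubic.scaleX, PlaneCubic.swapXY]
    rw [h, hA.swapXY, hA.scaleX, hA.swapXY]) n U
  have h2 := vol_add_scale (A := A) (w := 1) (fun c => by
    rw [← hA.smul c]
    apply iff_of_eq; congr 1
    funext i; simp [scale_apply]) n' U
  rw [h, h2] at h1
  have hp : ((p : ℝ)⁻¹) ^ 10 ≠ 0 :=
    pow_ne_zero _ (inv_ne_zero (by exact_mod_cast (Fact.out : p.Prime).ne_zero))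
  exact (mul_left_cancel₀ hp (by simpa [Fin.sum_univ_succ] using h1)).symm

lemma vol_add_one (hA : IsInsolubleLocus A) {n n' : Fin 10 → ℕ} (U : Finset (Fin 10))
    (h : n' = n + 1) : vol A n' U = ((p : ℝ)⁻¹) ^ 10 * vol A n U := by
  rw [h, vol_add_scale (A := A) (w := 1) (fun c => by
    rw [← hA.smul c]
    apply iff_of_eq; congr 1
    funext i; simp [scale_apply]) n U]
  simp

lemma vol_swapYZ (hA : IsInsolubleLocus A) {n n' : Fin 10 → ℕ}
    (h : n' = ![n 0, n 2, n 1, n 5, n 4, n 3, n 9, n 8, n 7, n 6]) :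
    vol A n {0, 6, 9} = vol A n' {0, 6, 9} := by
  unfold vol
  rw [← hA.isSymmetry_swapYZ.measure_preimage (box p n' _)]
  congr 2
  subst h
  ext c
  constructor
  · intro hc i
    have h0 := hc 0; have h1 := hc 1; have h2 := hc 2; have h3 := hc 3; have h4 := hc 4
    have h5 := hc 5; have h6 := hc 6; have h7 := hc 7; have h8 := hc 8; have h9 := hc 9
    fin_cases i <;> simp_all [PlaneCubic.swapYZ]
  · intro hc i
    have h0 := hc 0; have h1 := hc 1; have h2 := hc 2; have h3 := hc 3; have h4 := hc 4
    have h5 := hc 5; have h6 := hc 6; have h7 := hc 7; have h8 := hc 8; have h9 := hc 9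
    fin_cases i <;> simp_all [PlaneCubic.swapYZ]

/-- An insoluble form whose reduction has no `X³` term reduces to a form in `Y` and `Z`. -/
lemma red_eq_zero_of_red_zero (hA : IsInsolubleLocus A) {c : Fin 10 → ℤ_[p]} (hc : c ∈ A)
    (h0 : red c 0 = 0) : red c 1 = 0 ∧ red c 2 = 0 ∧ red c 3 = 0 ∧ red c 4 = 0 ∧ red c 5 = 0 := by
  rcases hA.reduction c hc with h | ⟨a, u, v, ha, h⟩ | ⟨a, u, ha, h⟩ | ⟨a, ha, h⟩
  · simp [h]
  · rw [h] at h0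
    simp [cubeCoeff, ha] at h0
  · simp [h, cubeCoeff]
  · simp [h, cubeCoeff]

/-- An insoluble form whose reduction has neither an `X³` nor a `Y³` term reduces to a multiple of
`Z³`. -/
lemma red_eight_eq_zero (hA : IsInsolubleLocus A) {c : Fin 10 → ℤ_[p]} (hc : c ∈ A)
    (h0 : red c 0 = 0) (h6 : red c 6 = 0) : red c 8 = 0 := by
  rcases hA.reduction c hc with h | ⟨a, u, v, ha, h⟩ | ⟨a, u, ha, h⟩ | ⟨a, ha, h⟩
  · simp [h]
  · rw [h] at h0
    simp [cubeCoeff, ha] at h0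
  · rw [h] at h6
    simp [cubeCoeff, ha] at h6
  · simp [h, cubeCoeff]

end IsInsolubleLocus

variable (p) in
/-- The set of forms reducing to a nonzero multiple of the `j`-th monomial. -/
def monomialLocus (j : Fin 10) : Set (Fin 10 → ℤ_[p]) :=
  {c | red c j ≠ 0 ∧ ∀ i, i ≠ j → red c i = 0}

lemma box_inter_monomialLocus {n n' : Fin 10 → ℕ} {U : Finset (Fin 10)} {j : Fin 10} (hj : n j = 0)
    (hj' : n' j = 0) (hn : ∀ i, i ≠ j → n' i = max (n i) 1) (hU : ∀ i ∈ U, i ≠ j → 1 ≤ n i) :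
    box p n U ∩ monomialLocus p j = box p n' (insert j U) := by
  ext c
  simp only [monomialLocus, Set.mem_inter_iff, Set.mem_ofPred_eq, red_eq_zero_iff, ne_eq]
  constructor
  · rintro ⟨hc, h1, h2⟩ i
    by_cases hi : i = j
    · subst hi
      simp [hj', h1]
    · rw [hn i hi]
      refine ⟨?_, fun hiU => ?_⟩
      · rcases le_total (n i) 1 with h | h
        · rw [max_eq_right h, pow_one]; exact h2 i hi
        · rw [max_eq_left h]; exact (hc i).1
      · have hiU' := (Finset.mem_insert.1 hiU).resolve_left hi
        rw [max_eq_left (hU i hiU' hi)]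
        exact (hc i).2 hiU'
  · intro hc
    refine ⟨fun i => ?_, ?_, fun i hi => ?_⟩
    · have h := hc i
      by_cases hi : i = j
      · subst hi
        rw [hj'] at h
        rw [hj]
        exact ⟨h.1, fun hiU => h.2 (Finset.mem_insert_of_mem hiU)⟩
      · rw [hn i hi] at h
        refine ⟨(pow_dvd_pow _ (le_max_left _ _)).trans h.1, fun hiU => ?_⟩
        have := h.2 (Finset.mem_insert_of_mem hiU)
        rwa [max_eq_left (hU i hiU hi)] at this
    · have h := (hc j).2 (Finset.mem_insert_self _ _)
      rwa [hj', zero_add, pow_one] at h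
    · have h := (hc i).1
      rw [hn i hi] at h
      exact (dvd_pow_self _ (by have := le_max_right (n i) 1; omega)).trans h

lemma mem_monomialLocus_zero_iff {c : Fin 10 → ℤ_[p]} :
    c ∈ monomialLocus p 0 ↔ ∃ a, a ≠ 0 ∧ red c = cubeCoeff a 1 0 0 := by
  constructor
  · rintro ⟨h, h'⟩
    refine ⟨red c 0, h, ?_⟩
    apply funext_fin10 <;> simp [cubeCoeff, h']
  · rintro ⟨a, ha, h⟩
    refine ⟨by simpa [h, cubeCoeff] using ha, fun i hi => ?_⟩
    rw [h]
    fin_cases i <;> simp_all [cubeCoeff]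

lemma mem_monomialLocus_six_iff {c : Fin 10 → ℤ_[p]} :
    c ∈ monomialLocus p 6 ↔ ∃ a, a ≠ 0 ∧ red c = cubeCoeff a 0 1 0 := by
  constructor
  · rintro ⟨h, h'⟩
    refine ⟨red c 6, h, ?_⟩
    apply funext_fin10 <;> simp [cubeCoeff, h']
  · rintro ⟨a, ha, h⟩
    refine ⟨by simpa [h, cubeCoeff] using ha, fun i hi => ?_⟩
    rw [h]
    fin_cases i <;> simp_all [cubeCoeff]

lemma shearX_cubeCoeff {R : Type*} [CommRing R] (a u v : R) :
    shearX u v (cubeCoeff a 1 0 0) = cubeCoeff a 1 u v := by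
  apply funext_fin10 <;> simp [shearX, cubeCoeff] <;> ring

lemma shearY_cubeCoeff {R : Type*} [CommRing R] (a u : R) :
    shearY u (cubeCoeff a 0 1 0) = cubeCoeff a 0 1 u := by
  apply funext_fin10 <;> simp [shearY, cubeCoeff] <;> ring

lemma swapXY_cubeCoeff {R : Type*} [CommRing R] (a l m n : R) :
    swapXY (cubeCoeff a l m n) = cubeCoeff a m l n := by
  apply funext_fin10 <;> simp [swapXY, cubeCoeff] <;> ring

lemma swapYZ_cubeCoeff {R : Type*} [CommRing R] (a l m n : R) :
    swapYZ (cubeCoeff a l m n) = cubeCoeff a l n m := by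
  apply funext_fin10 <;> simp [swapYZ, cubeCoeff] <;> ring

lemma toZMod_val (u : ZMod p) : PadicInt.toZMod ((u.val : ℕ) : ℤ_[p]) = u := by
  rw [map_natCast, ZMod.natCast_zmod_val]

/-- The change of variables moving the line `X + uY + vZ = 0` to `X = 0`. -/
def moveX (u v : ZMod p) : (Fin 10 → ℤ_[p]) → Fin 10 → ℤ_[p] :=
  shearX (-(u.val : ℤ_[p])) (-(v.val : ℤ_[p]))

/-- The change of variables moving the line `Y + uZ = 0` to `Y = 0`. -/
def moveY (u : ZMod p) : (Fin 10 → ℤ_[p]) → Fin 10 → ℤ_[p] := shearY (-(u.val : ℤ_[p]))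

lemma moveX_mem_monomialLocus_iff (u v : ZMod p) (c : Fin 10 → ℤ_[p]) :
    moveX u v c ∈ monomialLocus p 0 ↔ ∃ a, a ≠ 0 ∧ red c = cubeCoeff a 1 u v := by
  rw [mem_monomialLocus_zero_iff]
  refine exists_congr fun a => and_congr_right fun _ => ?_
  have h : red (moveX u v c) = shearX (-u) (-v) (red c) := by
    rw [red, moveX, map_shearX, map_neg, map_neg, toZMod_val, toZMod_val]; rfl
  rw [h]
  constructor
  · intro h
    rw [← shearX_cubeCoeff, ← h, shearX_shearX_neg]
  · intro h
    rw [h, ← shearX_cubeCoeff a u v, shearX_neg_shearX]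

lemma moveY_mem_monomialLocus_iff (u : ZMod p) (c : Fin 10 → ℤ_[p]) :
    moveY u c ∈ monomialLocus p 6 ↔ ∃ a, a ≠ 0 ∧ red c = cubeCoeff a 0 1 u := by
  rw [mem_monomialLocus_six_iff]
  refine exists_congr fun a => and_congr_right fun _ => ?_
  have h : red (moveY u c) = shearY (-u) (red c) := by
    rw [red, moveY, map_shearY, map_neg, toZMod_val]; rfl
  rw [h]
  constructor
  · intro h
    rw [← shearY_cubeCoeff, ← h, shearY_shearY_neg]
  · intro h
    rw [h, ← shearY_cubeCoeff a u, shearY_neg_shearY]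

lemma red_swapXY (c : Fin 10 → ℤ_[p]) : red (swapXY c) = swapXY (red c) := map_swapXY _ c

lemma red_swapYZ (c : Fin 10 → ℤ_[p]) : red (swapYZ c) = swapYZ (red c) := map_swapYZ _ c

lemma red_swapXY_eq_iff {c : Fin 10 → ℤ_[p]} {a l m n : ZMod p} :
    red (swapXY c) = cubeCoeff a l m n ↔ red c = cubeCoeff a m l n := by
  rw [red_swapXY]
  constructor
  · intro h
    rw [← swapXY_cubeCoeff, ← h, swapXY_swapXY]
  · intro h
    rw [h, swapXY_cubeCoeff]

lemma red_swapYZ_eq_iff {c : Fin 10 → ℤ_[p]} {a l m n : ZMod p} :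
    red (swapYZ c) = cubeCoeff a l m n ↔ red c = cubeCoeff a l n m := by
  rw [red_swapYZ]
  constructor
  · intro h
    rw [← swapYZ_cubeCoeff, ← h, swapYZ_swapYZ]
  · intro h
    rw [h, swapYZ_cubeCoeff]

/-- The slope of a triple line is determined by the form; in characteristic `3` because Frobenius
is injective. -/
lemma eq_of_mul_eq_of_mul_cube_eq {a u u' : ZMod p} (ha : a ≠ 0) (h1 : 3 * a * u = 3 * a * u')
    (h3 : a * u ^ 3 = a * u' ^ 3) : u = u' := by
  by_cases h : (3 : ZMod p) = 0
  · have hp : p = 3 := by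
      have : p ∣ 3 := (ZMod.natCast_eq_zero_iff 3 p).1 (by exact_mod_cast h)
      exact (Nat.prime_dvd_prime_iff_eq Fact.out Nat.prime_three).1 this
    have hcube : ∀ x : ZMod p, x ^ 3 = x := by
      subst hp
      exact fun x => ZMod.pow_card x
    rw [hcube, hcube] at h3
    exact mul_left_cancel₀ ha h3
  · exact mul_left_cancel₀ (mul_ne_zero h ha) h1

lemma cubeCoeff_one_inj {a a' u u' v v' : ZMod p} (ha : a ≠ 0)
    (h : cubeCoeff a 1 u v = cubeCoeff a' 1 u' v') : u = u' ∧ v = v' := by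
  have h0 := congrFun h 0
  have h1 := congrFun h 1
  have h2 := congrFun h 2
  have h6 := congrFun h 6
  have h9 := congrFun h 9
  simp only [cubeCoeff, Matrix.cons_val, one_pow, mul_one] at h0 h1 h2 h6 h9
  subst h0
  exact ⟨eq_of_mul_eq_of_mul_cube_eq ha h1 h6, eq_of_mul_eq_of_mul_cube_eq ha h2 h9⟩

lemma cubeCoeff_zero_one_inj {a a' u u' : ZMod p} (ha : a ≠ 0)
    (h : cubeCoeff a 0 1 u = cubeCoeff a' 0 1 u') : u = u' := by
  have h6 := congrFun h 6
  have h7 := congrFun h 7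
  have h9 := congrFun h 9
  simp only [cubeCoeff, Matrix.cons_val, one_pow, mul_one] at h6 h7 h9
  subst h6
  exact eq_of_mul_eq_of_mul_cube_eq ha h7 h9

namespace IsInsolubleLocus

/-- The change of variables moving a line of the projective plane over `𝔽_p` to `X = 0`. The lines
are `X + uY + vZ = 0`, `Y + uZ = 0` and `Z = 0`. -/
def moveLine : (ZMod p × ZMod p) ⊕ Option (ZMod p) → (Fin 10 → ℤ_[p]) → Fin 10 → ℤ_[p]
  | .inl (u, v) => moveX u v
  | .inr (some u) => moveX 0 u ∘ PlaneCubic.swapXY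
  | .inr none => PlaneCubic.swapXY ∘ PlaneCubic.swapYZ

/-- The change of variables moving a point of the projective line over `𝔽_p`, seen as a linear
form in `Y` and `Z`, to `Y`. -/
def movePoint : Option (ZMod p) → (Fin 10 → ℤ_[p]) → Fin 10 → ℤ_[p]
  | some u => moveY u
  | none => PlaneCubic.swapYZ

lemma isSymmetry_moveLine (hA : IsInsolubleLocus A) (t) : IsSymmetry A (moveLine (p := p) t) :=
  match t with
  | .inl _ => hA.isSymmetry_shearX _ _
  | .inr (some _) => (hA.isSymmetry_shearX _ _).comp hA.isSymmetry_swapXY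
  | .inr none => hA.isSymmetry_swapXY.comp hA.isSymmetry_swapYZ

lemma isSymmetry_movePoint (hA : IsInsolubleLocus A) (t) : IsSymmetry A (movePoint (p := p) t) :=
  match t with
  | some _ => hA.isSymmetry_shearY _
  | none => hA.isSymmetry_swapYZ

lemma moveLine_mem_monomialLocus_iff (c : Fin 10 → ℤ_[p]) (t) : moveLine t c ∈ monomialLocus p 0 ↔
    ∃ a, a ≠ 0 ∧ red c = match t with
      | .inl (u, v) => cubeCoeff a 1 u v
      | .inr (some u) => cubeCoeff a 0 1 u
      | .inr none => cubeCoeff a 0 0 1 := by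
  rcases t with ⟨u, v⟩ | _ | u
  · exact moveX_mem_monomialLocus_iff u v c
  · simp only [moveLine, Function.comp, mem_monomialLocus_zero_iff, red_swapXY_eq_iff,
      red_swapYZ_eq_iff]
  · simp only [moveLine, Function.comp, moveX_mem_monomialLocus_iff, red_swapXY_eq_iff]

lemma movePoint_mem_monomialLocus_iff (c : Fin 10 → ℤ_[p]) (t) : movePoint t c ∈ monomialLocus p 6 ↔
    ∃ a, a ≠ 0 ∧ red c = match t with
      | some u => cubeCoeff a 0 1 u
      | none => cubeCoeff a 0 0 1 := by
  rcases t with _ | u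
  · simp only [movePoint, mem_monomialLocus_six_iff, red_swapYZ_eq_iff]
  · exact moveY_mem_monomialLocus_iff u c

lemma exists_moveLine_iff (c : Fin 10 → ℤ_[p]) :
    (∃ t, moveLine t c ∈ monomialLocus p 0) ↔ IsTripleLine (red c) := by
  simp only [moveLine_mem_monomialLocus_iff, Sum.exists, Option.exists, Prod.exists, IsTripleLine]
  constructor
  · rintro (⟨u, v, a, h⟩ | ⟨a, h⟩ | ⟨u, a, h⟩)
    · exact Or.inl ⟨a, u, v, h⟩
    · exact Or.inr (Or.inr ⟨a, h⟩)
    · exact Or.inr (Or.inl ⟨a, u, h⟩)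
  · rintro (⟨a, u, v, h⟩ | ⟨a, u, h⟩ | ⟨a, h⟩)
    · exact Or.inl ⟨u, v, a, h⟩
    · exact Or.inr (Or.inr ⟨u, a, h⟩)
    · exact Or.inr (Or.inl ⟨a, h⟩)

lemma moveLine_inj (c : Fin 10 → ℤ_[p]) (s t) (hs : moveLine s c ∈ monomialLocus p 0)
    (ht : moveLine t c ∈ monomialLocus p 0) : s = t := by
  rw [moveLine_mem_monomialLocus_iff] at hs ht
  obtain ⟨a, ha, hs⟩ := hs
  obtain ⟨b, hb, ht⟩ := ht
  rw [hs] at ht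
  rcases s with ⟨u, v⟩ | _ | u <;> rcases t with ⟨u', v'⟩ | _ | u' <;> simp only at ht
  · obtain ⟨rfl, rfl⟩ := cubeCoeff_one_inj ha ht
    rfl
  · exact absurd (congrFun ht 0) (by simp [cubeCoeff, ha])
  · exact absurd (congrFun ht 0) (by simp [cubeCoeff, ha])
  · exact absurd (congrFun ht 0) (by simp [cubeCoeff, hb.symm])
  · rfl
  · exact absurd (congrFun ht 6) (by simp [cubeCoeff, hb.symm])
  · exact absurd (congrFun ht 0) (by simp [cubeCoeff, hb.symm])
  · exact absurd (congrFun ht 6) (by simp [cubeCoeff, ha])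
  · rw [cubeCoeff_zero_one_inj ha ht]

lemma movePoint_inj (c : Fin 10 → ℤ_[p]) (s t) (hs : movePoint s c ∈ monomialLocus p 6)
    (ht : movePoint t c ∈ monomialLocus p 6) : s = t := by
  rw [movePoint_mem_monomialLocus_iff] at hs ht
  obtain ⟨a, ha, hs⟩ := hs
  obtain ⟨b, hb, ht⟩ := ht
  rw [hs] at ht
  rcases s with _ | u <;> rcases t with _ | u' <;> simp only at ht
  · rfl
  · exact absurd (congrFun ht 6) (by simp [cubeCoeff, hb.symm])
  · exact absurd (congrFun ht 6) (by simp [cubeCoeff, ha])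
  · rw [cubeCoeff_zero_one_inj ha ht]

lemma measurableSet_monomialLocus (j : Fin 10) : MeasurableSet (monomialLocus p j) := by
  have h : box p 0 ∅ = Set.univ := by ext c; simp [box]
  have := box_inter_monomialLocus (p := p) (n := 0) (n' := fun i => if i = j then 0 else 1) (U := ∅)
    (j := j) rfl (by simp) (fun i hi => by simp [hi]) (by simp)
  rw [h, Set.univ_inter] at this
  rw [this]
  exact measurableSet_box _ _

/-- An insoluble form is divisible by `p` or reduces to one of `p² + p + 1` triple lines. -/
lemma vol_zero_empty (hA : IsInsolubleLocus A) : vol A 0 ∅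
    = vol A 1 ∅ + (p ^ 2 + p + 1) * vol A ![0, 1, 1, 1, 1, 1, 1, 1, 1, 1] {0} := by
  have h0 : box p 0 ∅ = Set.univ := by ext c; simp [box]
  have h1 : ∀ c : Fin 10 → ℤ_[p], c ∈ box p 1 ∅ ↔ red c = 0 := by
    intro c
    simp [box, funext_iff, red_eq_zero_iff]
  have hcount := measure_inter_eq_card_mul (E := (box p 1 ∅)ᶜ) (E' := monomialLocus p 0)
    hA.isSymmetry_moveLine (measurableSet_monomialLocus 0) (fun c hc => by
      rw [exists_moveLine_iff, Set.mem_compl_iff, h1]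
      refine ⟨fun h => (hA.reduction c hc).resolve_left h, fun h h' => ?_⟩
      rw [h'] at h
      rcases h with ⟨a, u, v, ha, h⟩ | ⟨a, u, ha, h⟩ | ⟨a, ha, h⟩
      · exact ha (by simpa [cubeCoeff] using (congrFun h 0).symm)
      · exact ha (by simpa [cubeCoeff] using (congrFun h 6).symm)
      · exact ha (by simpa [cubeCoeff] using (congrFun h 9).symm)) moveLine_inj
  have hpure : monomialLocus p 0 = box p ![0, 1, 1, 1, 1, 1, 1, 1, 1, 1] {0} := by
    rw [← Set.univ_inter (monomialLocus p 0), ← h0]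
    exact box_inter_monomialLocus rfl rfl (by decide) (by simp)
  have hsplit := measureReal_inter_add_sdiff (μ := cubicMeasure p) (s := A)
    (measurableSet_box (p := p) 1 ∅)
  rw [Set.sdiff_eq, hcount, hpure] at hsplit
  unfold vol
  rw [h0, Set.inter_univ, ← hsplit]
  simp [Fintype.card_sum, Fintype.card_prod, ZMod.card]
  left; ring

/-- An insoluble form with unit `X³` coefficient reduces to one of `p²` triple lines. -/
lemma vol_zero_singleton (hA : IsInsolubleLocus A) :
    vol A 0 {0} = p ^ 2 * vol A ![0, 1, 1, 1, 1, 1, 1, 1, 1, 1] {0} := by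
  have hmem : ∀ c : Fin 10 → ℤ_[p], c ∈ box p 0 {0} ↔ red c 0 ≠ 0 := by
    intro c
    simp [box, red_eq_zero_iff]
  have h0 : box p 0 ∅ = Set.univ := by ext c; simp [box]
  have hcount := measure_inter_eq_card_mul (E := box p 0 {0}) (E' := monomialLocus p 0)
    (f := fun t : ZMod p × ZMod p => moveLine (.inl t))
    (fun t => hA.isSymmetry_moveLine _) (measurableSet_monomialLocus 0) (fun c hc => by
      simp only [moveLine_mem_monomialLocus_iff, hmem]
      constructor
      · intro h
        rcases hA.reduction c hc with h' | ⟨a, u, v, ha, h'⟩ | ⟨a, u, ha, h'⟩ | ⟨a, ha, h'⟩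
        · simp [h'] at h
        · exact ⟨(u, v), a, ha, h'⟩
        · simp [h', cubeCoeff] at h
        · simp [h', cubeCoeff] at h
      · rintro ⟨⟨u, v⟩, a, ha, h⟩
        simpa [h, cubeCoeff] using ha)
    (fun c s t hs ht => Sum.inl_injective (moveLine_inj c _ _ hs ht))
  have hpure : monomialLocus p 0 = box p ![0, 1, 1, 1, 1, 1, 1, 1, 1, 1] {0} := by
    rw [← Set.univ_inter (monomialLocus p 0), ← h0]
    exact box_inter_monomialLocus rfl rfl (by decide) (by simp)
  unfold vol
  rw [hcount, hpure]
  simp [Fintype.card_prod, ZMod.card]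
  left; ring

end IsInsolubleLocus

end Recursion

/-! ### The measure of an insoluble locus -/

section Measure

variable {p : ℕ} [Fact p.Prime]

lemma box_singleton_iff {a b g : ℕ} {c : Fin 10 → ℤ_[p]} :
    c ∈ box p ![a, b, b, g, g, g, 0, 0, 0, 0] {0} ↔
      ((p : ℤ_[p]) ^ a ∣ c 0 ∧ ¬ (p : ℤ_[p]) ^ (a + 1) ∣ c 0) ∧
      ((p : ℤ_[p]) ^ b ∣ c 1 ∧ (p : ℤ_[p]) ^ b ∣ c 2) ∧
      ((p : ℤ_[p]) ^ g ∣ c 3 ∧ (p : ℤ_[p]) ^ g ∣ c 4 ∧ (p : ℤ_[p]) ^ g ∣ c 5) := by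
  simp [box, Fin.forall_fin_succ]
  tauto

lemma shearY_mem_box {a b g : ℕ} (u : ℤ_[p]) {c : Fin 10 → ℤ_[p]}
    (hc : c ∈ box p ![a, b, b, g, g, g, 0, 0, 0, 0] {0}) :
    shearY u c ∈ box p ![a, b, b, g, g, g, 0, 0, 0, 0] {0} := by
  rw [box_singleton_iff] at hc ⊢
  obtain ⟨h0, ⟨h1, h2⟩, h3, h4, h5⟩ := hc
  simp only [shearY, Matrix.cons_val]
  exact ⟨h0, ⟨h1, dvd_add (h1.mul_left _) h2⟩, h3, dvd_add (h3.mul_left _) h4,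
    dvd_add (dvd_add (h3.mul_left _) (h4.mul_left _)) h5⟩

lemma shearY_mem_box_iff {a b g : ℕ} (u : ℤ_[p]) {c : Fin 10 → ℤ_[p]} :
    shearY u c ∈ box p ![a, b, b, g, g, g, 0, 0, 0, 0] {0} ↔
      c ∈ box p ![a, b, b, g, g, g, 0, 0, 0, 0] {0} := by
  refine ⟨fun h => ?_, shearY_mem_box u⟩
  simpa only [shearY_neg_shearY] using shearY_mem_box (-u) h

lemma swapYZ_mem_box_iff {a b g : ℕ} {c : Fin 10 → ℤ_[p]} :
    swapYZ c ∈ box p ![a, b, b, g, g, g, 0, 0, 0, 0] {0} ↔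
      c ∈ box p ![a, b, b, g, g, g, 0, 0, 0, 0] {0} := by
  rw [box_singleton_iff, box_singleton_iff]
  simp only [swapYZ, Matrix.cons_val]
  tauto

lemma shearX_mem_box {d : ℕ} (hd : d ≤ 1) (v : ℤ_[p]) {c : Fin 10 → ℤ_[p]}
    (hc : c ∈ box p ![0, 1, 0, d + 1, d, 0, d + 1, d + 1, d, 0] {6}) :
    shearX 0 v c ∈ box p ![0, 1, 0, d + 1, d, 0, d + 1, d + 1, d, 0] {6} := by
  have hbox : ∀ c : Fin 10 → ℤ_[p], c ∈ box p ![0, 1, 0, d + 1, d, 0, d + 1, d + 1, d, 0] {6} ↔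
      ((p : ℤ_[p]) ^ 1 ∣ c 1 ∧ (p : ℤ_[p]) ^ (d + 1) ∣ c 3 ∧ (p : ℤ_[p]) ^ d ∣ c 4) ∧
      ((p : ℤ_[p]) ^ (d + 1) ∣ c 6 ∧ ¬ (p : ℤ_[p]) ^ (d + 1 + 1) ∣ c 6) ∧
      (p : ℤ_[p]) ^ (d + 1) ∣ c 7 ∧ (p : ℤ_[p]) ^ d ∣ c 8 := by
    intro c
    simp [box, Fin.forall_fin_succ]
    tauto
  rw [hbox] at hc ⊢
  obtain ⟨⟨h1, h3, h4⟩, h6, h7, h8⟩ := hc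
  have h1' := (pow_dvd_pow (p : ℤ_[p]) hd).trans h1
  simp only [shearX, Matrix.cons_val, mul_zero, zero_mul, zero_add, ne_eq, OfNat.ofNat_ne_zero,
    not_false_eq_true, zero_pow, add_zero]
  exact ⟨⟨h1, h3, dvd_add (h1'.mul_left _) h4⟩, h6, dvd_add (h3.mul_left _) h7,
    dvd_add (dvd_add (h1'.mul_left _) (h4.mul_left _)) h8⟩

lemma moveX_mem_box_iff {d : ℕ} (hd : d ≤ 1) (v : ZMod p) {c : Fin 10 → ℤ_[p]} :
    moveX 0 v c ∈ box p ![0, 1, 0, d + 1, d, 0, d + 1, d + 1, d, 0] {6} ↔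
      c ∈ box p ![0, 1, 0, d + 1, d, 0, d + 1, d + 1, d, 0] {6} := by
  rw [moveX, ZMod.val_zero, Nat.cast_zero, neg_zero]
  refine ⟨fun h => ?_, shearX_mem_box hd _⟩
  have := shearX_mem_box hd (v.val : ℤ_[p]) h
  rwa [shearX_shearX, add_neg_cancel, zero_add, shearX_zero] at this

lemma insert_mem_box_iff {n : Fin 10 → ℕ} {U : Finset (Fin 10)} {j : Fin 10} (hj : n j = 0)
    {c : Fin 10 → ℤ_[p]} : c ∈ box p n (insert j U) ↔ c ∈ box p n U ∧ red c j ≠ 0 := by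
  constructor
  · intro h
    refine ⟨fun i => ⟨(h i).1, fun hi => (h i).2 (Finset.mem_insert_of_mem hi)⟩, ?_⟩
    have := (h j).2 (Finset.mem_insert_self _ _)
    rwa [hj, zero_add, pow_one, ← red_eq_zero_iff] at this
  · rintro ⟨h, hr⟩ i
    refine ⟨(h i).1, fun hi => ?_⟩
    rcases Finset.mem_insert.1 hi with rfl | hi
    · rwa [hj, zero_add, pow_one, ← red_eq_zero_iff]
    · exact (h i).2 hi

lemma red_eq_zero_of_mem_box {n : Fin 10 → ℕ} {U : Finset (Fin 10)} {c : Fin 10 → ℤ_[p]}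
    (hc : c ∈ box p n U) {i : Fin 10} (hi : 1 ≤ n i) : red c i = 0 :=
  red_eq_zero_iff.2 ((dvd_pow_self _ (by omega)).trans (hc i).1)

namespace IsInsolubleLocus

variable {A : Set (Fin 10 → ℤ_[p])}

/-- The forms of a box whose reduction is moved to the `j`-th monomial by one of the symmetries
`f t` preserving the box. -/
lemma vol_inter_eq_card_mul {ι : Type*} [Fintype ι]
    {f : ι → (Fin 10 → ℤ_[p]) → Fin 10 → ℤ_[p]} (hf : ∀ t, IsSymmetry A (f t))
    {n n' : Fin 10 → ℕ} {U V : Finset (Fin 10)} {j : Fin 10} {S : Set (Fin 10 → ℤ_[p])}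
    (hbox : ∀ t c, f t c ∈ box p n U ↔ c ∈ box p n U)
    (hj : n j = 0) (hj' : n' j = 0) (hn : ∀ i, i ≠ j → n' i = max (n i) 1)
    (hU : ∀ i ∈ U, i ≠ j → 1 ≤ n i) (hV : V = insert j U)
    (hcover : ∀ c ∈ A, c ∈ box p n U → (c ∈ S ↔ ∃ t, f t c ∈ monomialLocus p j))
    (huniq : ∀ c s t, f s c ∈ monomialLocus p j → f t c ∈ monomialLocus p j → s = t) :
    (cubicMeasure p).real (A ∩ (box p n U ∩ S)) = Fintype.card ι * vol A n' V := by
  rw [measure_inter_eq_card_mul hf (E' := box p n U ∩ monomialLocus p j)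
    ((measurableSet_box _ _).inter (measurableSet_monomialLocus j)) (fun c hc => ?_)
    (fun c s t hs ht => huniq c s t hs.2 ht.2), box_inter_monomialLocus hj hj' hn hU, hV, vol]
  simp only [Set.mem_inter_iff, hbox, exists_and_left]
  exact and_congr_right fun hb => hcover c hc hb

/-- A form in the box reduces to a cubic form in `Y` and `Z`, which is zero or has one of `p + 1`
triple roots. -/
lemma vol_triple_root (hA : IsInsolubleLocus A) {a b g : ℕ} (ha : 1 ≤ a) (hb : 1 ≤ b)
    (hg : 1 ≤ g) : vol A ![a, b, b, g, g, g, 0, 0, 0, 0] {0}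
    = vol A ![a, b, b, g, g, g, 1, 1, 1, 1] {0}
      + (p + 1) * vol A ![a, b, b, g, g, g, 0, 1, 1, 1] {0, 6} := by
  have hcount := vol_inter_eq_card_mul (A := A) hA.isSymmetry_movePoint
    (n := ![a, b, b, g, g, g, 0, 0, 0, 0]) (n' := ![a, b, b, g, g, g, 0, 1, 1, 1]) (U := {0})
    (V := {0, 6}) (j := 6) (S := {c | red c ≠ 0})
    (fun t c => by
      rcases t with _ | u
      exacts [swapYZ_mem_box_iff, shearY_mem_box_iff _])
    rfl rfl (by intro i hi; fin_cases i <;> simp_all) (by simpa using ha) (by decide)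
    (fun c hc hbox => by
      simp only [movePoint_mem_monomialLocus_iff, Set.mem_ofPred_eq, Option.exists]
      constructor
      · intro h
        rcases hA.reduction c hc with h' | ⟨l, u, v, hl, h'⟩ | ⟨l, u, hl, h'⟩ | ⟨l, hl, h'⟩
        · exact absurd h' h
        · have := red_eq_zero_of_mem_box hbox (i := 0) ha
          simp [h', cubeCoeff, hl] at this
        · exact Or.inr ⟨u, l, hl, h'⟩
        · exact Or.inl ⟨l, hl, h'⟩
      · rintro (⟨l, hl, h⟩ | ⟨u, l, hl, h⟩) h' <;> rw [h'] at h
        · exact hl (by simpa [cubeCoeff] using (congrFun h 9).symm)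
        · exact hl (by simpa [cubeCoeff] using (congrFun h 6).symm)) movePoint_inj
  have h1 : A ∩ box p ![a, b, b, g, g, g, 0, 0, 0, 0] {0} ∩ {c | red c = 0}
      = A ∩ box p ![a, b, b, g, g, g, 1, 1, 1, 1] {0} := by
    rw [Set.inter_assoc]
    congr 1
    ext c
    simp only [Set.mem_inter_iff, Set.mem_ofPred_eq]
    constructor
    · rintro ⟨hc, hr⟩ i
      have hi := hc i
      have hri := red_eq_zero_iff.1 (congrFun hr i)
      fin_cases i <;> simp_all
    · intro hc
      refine ⟨fun i => ?_, funext fun i => red_eq_zero_of_mem_box hc ?_⟩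
      · have hi := hc i
        fin_cases i <;> simp_all
      · fin_cases i <;> simp [ha, hb, hg]
  have hm : MeasurableSet {c : Fin 10 → ℤ_[p] | red c = 0} := by
    convert measurableSet_box (p := p) 1 ∅ using 1
    ext c
    simp [box, funext_iff, red_eq_zero_iff]
  have h2 := measureReal_inter_add_sdiff (μ := cubicMeasure p)
    (s := A ∩ box p ![a, b, b, g, g, g, 0, 0, 0, 0] {0}) hm
  rw [h1, Set.sdiff_eq, Set.inter_assoc A] at h2
  rw [vol, ← h2, vol]
  congr 1
  refine hcount.trans ?_
  simp [ZMod.card]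

/-- A form in the box reduces to a cubic form in `Y` and `Z` with a `Y³` term, which has one of `p`
triple roots. -/
lemma vol_triple_root_affine (hA : IsInsolubleLocus A) {a b g : ℕ} (ha : 1 ≤ a)
    (hb : 1 ≤ b) (hg : 1 ≤ g) :
    vol A ![a, b, b, g, g, g, 0, 0, 0, 0] {0, 6}
    = p * vol A ![a, b, b, g, g, g, 0, 1, 1, 1] {0, 6} := by
  have hins : ({0, 6} : Finset (Fin 10)) = insert 6 {0} := by decide
  have hcount := vol_inter_eq_card_mul (A := A) (ι := ZMod p) (f := moveY)
    (fun t => hA.isSymmetry_shearY _)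
    (n := ![a, b, b, g, g, g, 0, 0, 0, 0])
    (n' := ![a, b, b, g, g, g, 0, 1, 1, 1]) (U := {0})
    (V := {0, 6}) (j := 6) (S := {c | red c 6 ≠ 0})
    (fun t c => shearY_mem_box_iff _)
    rfl rfl (by intro i hi; fin_cases i <;> simp_all) (by simpa using ha) hins
    (fun c hc hbox => by
      simp only [moveY_mem_monomialLocus_iff, Set.mem_ofPred_eq]
      constructor
      · intro h
        rcases hA.reduction c hc with h' | ⟨l, u, v, hl, h'⟩ | ⟨l, u, hl, h'⟩ | ⟨l, hl, h'⟩
        · simp [h'] at h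
        · have := red_eq_zero_of_mem_box hbox (i := 0) ha
          simp [h', cubeCoeff, hl] at this
        · exact ⟨u, l, hl, h'⟩
        · simp [h', cubeCoeff] at h
      · rintro ⟨u, l, hl, h⟩
        simpa [h, cubeCoeff] using hl)
    (fun c s t hs ht => Option.some_injective _ (movePoint_inj c (some s) (some t) hs ht))
  rw [ZMod.card] at hcount
  rw [← hcount, vol]
  congr 2
  ext c
  rw [hins, insert_mem_box_iff rfl]
  rfl

/-- A form in the box reduces to a triple line `X + vZ = 0`, since its reduction has an `X³` term
but no `Y³` term. -/
lemma vol_triple_line_affine (hA : IsInsolubleLocus A) {d : ℕ} (hd : d ≤ 1) :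
    vol A ![0, 1, 0, d + 1, d, 0, d + 1, d + 1, d, 0] {0, 6}
    = p * vol A ![0, 1, 1, d + 1, 1, 1, d + 1, d + 1, 1, 1] {0, 6} := by
  have hcount := vol_inter_eq_card_mul (A := A) (ι := ZMod p) (f := moveX 0)
    (fun t => hA.isSymmetry_shearX _ _)
    (n := ![0, 1, 0, d + 1, d, 0, d + 1, d + 1, d, 0])
    (n' := ![0, 1, 1, d + 1, 1, 1, d + 1, d + 1, 1, 1]) (U := {6})
    (V := {0, 6}) (j := 0) (S := {c | red c 0 ≠ 0})
    (fun t c => moveX_mem_box_iff hd t)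
    rfl rfl (by intro i hi; fin_cases i <;> simp_all) (by simp) (by decide)
    (fun c hc hbox => by
      simp only [moveX_mem_monomialLocus_iff, Set.mem_ofPred_eq]
      constructor
      · intro h
        have h6 := red_eq_zero_of_mem_box hbox (i := 6) (by simp)
        rcases hA.reduction c hc with h' | ⟨l, u, v, hl, h'⟩ | ⟨l, u, hl, h'⟩ | ⟨l, hl, h'⟩
        · simp [h'] at h
        · obtain rfl : u = 0 := by simpa [h', cubeCoeff, hl] using h6
          exact ⟨v, l, hl, h'⟩
        · simp [h', cubeCoeff] at h
        · simp [h', cubeCoeff] at h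
      · rintro ⟨u, l, hl, h⟩
        simpa [h, cubeCoeff] using hl)
    (fun c s t hs ht => (Prod.ext_iff.1 (Sum.inl_injective
      (moveLine_inj c (.inl (0, s)) (.inl (0, t)) hs ht))).2)
  rw [ZMod.card] at hcount
  rw [← hcount, vol]
  congr 2
  ext c
  rw [show ({0, 6} : Finset (Fin 10)) = insert 0 {6} by decide, insert_mem_box_iff rfl]
  rfl

lemma vol_critical (hA : IsInsolubleLocus A) :
    vol A critVal {0, 6, 9} = ((p : ℝ)⁻¹) ^ 13 * (1 - (p : ℝ)⁻¹) ^ 3 := by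
  have h := vol_univ_box (p := p) critVal
  rw [show ∑ i, critVal i = 13 by decide] at h
  rw [← h, vol, vol, Set.inter_eq_right.2 hA.critical, Set.univ_inter]

/-- The forms obtained from a form with reduction `X³` by substituting `pX` for `X` and dividing by
`p`, when the result reduces to `Y³`. Continuing with `Y` in the same way, such a form becomes
critical or, after a factor `p` is removed, returns to a form of the same kind. -/
lemma vol_line_point (hA : IsInsolubleLocus A) :
    (1 - ((p : ℝ)⁻¹) ^ 8) * vol A ![2, 2, 2, 1, 1, 1, 0, 1, 1, 1] {0, 6}
      = ((p : ℝ)⁻¹) ^ 13 * (1 - (p : ℝ)⁻¹) ^ 3 := by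
  have hp : (p : ℝ) ≠ 0 := by exact_mod_cast (Fact.out : p.Prime).ne_zero
  have h1 : vol A ![2, 2, 2, 1, 1, 1, 0, 1, 1, 1] {0, 6}
      = vol A ![1, 2, 1, 2, 1, 0, 2, 2, 1, 0] {0, 6} := hA.vol_shiftY _ (by decide)
  have h2 : vol A ![1, 2, 1, 2, 1, 0, 2, 2, 1, 0] {0, 6}
      = vol A ![1, 2, 1, 2, 1, 1, 2, 2, 1, 0] {0, 6} :=
    vol_restrict A (by decide) fun c hc hbox i => by
      have h5 := red_eq_zero_iff.1
        (hA.red_eq_zero_of_red_zero hc (red_eq_zero_of_mem_box hbox (i := 0) (by decide))).2.2.2.2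
      by_cases hi : i = 5
      · subst hi
        simpa using h5
      · convert (hbox i).1 using 2
        revert i; decide
  -- The reduction is now a multiple of `Z³`; the form is critical up to shifts if it is nonzero.
  have h3 := vol_split A (n := ![1, 2, 1, 2, 1, 1, 2, 2, 1, 0])
    (n' := ![1, 2, 1, 2, 1, 1, 2, 2, 1, 1]) (U := {0, 6}) 9 (by decide) (by decide)
  have h4 : vol A ![1, 2, 1, 2, 1, 1, 2, 2, 1, 0] {0, 6, 9}
      = vol A critVal {0, 6, 9} :=
    (hA.vol_shiftY (n := ![2, 2, 2, 1, 1, 2, 0, 1, 1, 1]) _ (by decide)).symm.trans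
      (hA.vol_shiftX _ (by decide)).symm
  have h5 : vol A ![1, 2, 1, 2, 1, 1, 2, 2, 1, 1] {0, 6}
      = ((p : ℝ)⁻¹) ^ 10 * vol A ![0, 1, 0, 1, 0, 0, 1, 1, 0, 0] {0, 6} :=
    hA.vol_add_one _ (by decide)
  have h6 : vol A ![0, 1, 0, 1, 0, 0, 1, 1, 0, 0] {0, 6}
      = p * vol A ![0, 1, 1, 1, 1, 1, 1, 1, 1, 1] {0, 6} :=
    hA.vol_triple_line_affine zero_le_one
  have h7 : vol A ![0, 1, 1, 1, 1, 1, 1, 1, 1, 1] {0, 6}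
      = vol A ![2, 2, 2, 1, 1, 1, 0, 0, 0, 0] {0, 6} := hA.vol_shiftX _ (by decide)
  have h8 := hA.vol_triple_root_affine (a := 2) (b := 2) (g := 1) (by decide) (by decide)
    (by decide)
  rw [show (insert 9 {0, 6} : Finset (Fin 10)) = {0, 6, 9} by decide, h4, h5, h6, h7, h8,
    hA.vol_critical, ← h2, ← h1] at h3
  field_simp at h3 ⊢
  linear_combination h3

/-- The analogue of `vol_line_point` for the forms in which a factor `p` has been removed after the
substitution of `pX` for `X`. -/
lemma vol_line_point_of_dvd (hA : IsInsolubleLocus A) :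
    (1 - ((p : ℝ)⁻¹) ^ 8) * vol A ![1, 1, 1, 1, 1, 1, 0, 1, 1, 1] {0, 6}
      = p * (((p : ℝ)⁻¹) ^ 13 * (1 - (p : ℝ)⁻¹) ^ 3) := by
  have hp : (p : ℝ) ≠ 0 := by exact_mod_cast (Fact.out : p.Prime).ne_zero
  have h1 : vol A ![1, 1, 1, 1, 1, 1, 0, 1, 1, 1] {0, 6}
      = vol A ![0, 1, 0, 2, 1, 0, 2, 2, 1, 0] {0, 6} := hA.vol_shiftY _ (by decide)
  have h2 : vol A ![0, 1, 0, 2, 1, 0, 2, 2, 1, 0] {0, 6}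
      = p * vol A ![0, 1, 1, 2, 1, 1, 2, 2, 1, 1] {0, 6} :=
    hA.vol_triple_line_affine le_rfl
  have h3 : vol A ![0, 1, 1, 2, 1, 1, 2, 2, 1, 1] {0, 6}
      = vol A ![2, 2, 2, 2, 1, 1, 1, 1, 0, 0] {0, 6} := hA.vol_shiftX _ (by decide)
  have h4 : vol A ![2, 2, 2, 2, 1, 1, 1, 1, 0, 0] {0, 6}
      = vol A ![2, 2, 2, 2, 1, 1, 1, 1, 1, 0] {0, 6} :=
    vol_restrict A (by decide) fun c hc hbox i => by
      have h8 := red_eq_zero_iff.1 (hA.red_eight_eq_zero hc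
        (red_eq_zero_of_mem_box hbox (i := 0) (by decide))
        (red_eq_zero_of_mem_box hbox (i := 6) (by decide)))
      by_cases hi : i = 8
      · subst hi
        simpa using h8
      · convert (hbox i).1 using 2
        revert i; decide
  -- The reduction is now a multiple of `Z³`; the form is critical up to shifts and the exchange of
  -- `Y` and `Z` if it is nonzero.
  have h5 := vol_split A (n := ![2, 2, 2, 2, 1, 1, 1, 1, 1, 0])
    (n' := ![2, 2, 2, 2, 1, 1, 1, 1, 1, 1]) (U := {0, 6}) 9 (by decide) (by decide)
  have h6 : vol A ![2, 2, 2, 2, 1, 1, 1, 1, 1, 0] {0, 6, 9}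
      = vol A critVal {0, 6, 9} :=
    (hA.vol_shiftX (n := ![0, 1, 1, 2, 1, 1, 2, 2, 2, 1]) _ (by decide)).symm.trans
      (hA.vol_swapYZ (by decide)).symm
  have h7 : vol A ![2, 2, 2, 2, 1, 1, 1, 1, 1, 1] {0, 6}
      = ((p : ℝ)⁻¹) ^ 10 * vol A ![1, 1, 1, 1, 0, 0, 0, 0, 0, 0] {0, 6} :=
    hA.vol_add_one _ (by decide)
  have h8 : vol A ![1, 1, 1, 1, 0, 0, 0, 0, 0, 0] {0, 6}
      = vol A ![1, 1, 1, 1, 1, 1, 0, 0, 0, 0] {0, 6} :=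
    vol_restrict A (by decide) fun c hc hbox i => by
      obtain ⟨-, -, -, h4, h5⟩ := hA.red_eq_zero_of_red_zero hc
        (red_eq_zero_of_mem_box hbox (i := 0) (by decide))
      rw [red_eq_zero_iff] at h4 h5
      by_cases hi : i = 4
      · subst hi
        simpa using h4
      · by_cases hi' : i = 5
        · subst hi'
          simpa using h5
        · convert (hbox i).1 using 2
          revert i; decide
  have h9 := hA.vol_triple_root_affine (a := 1) (b := 1) (g := 1) (by decide) (by decide)
    (by decide)
  rw [show (insert 9 {0, 6} : Finset (Fin 10)) = {0, 6, 9} by decide, h6, h7, h8, h9,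
    hA.vol_critical, ← h4, ← h3] at h5
  rw [h1, h2, ← h1] at *
  generalize vol A ![0, 1, 1, 2, 1, 1, 2, 2, 1, 1] {0, 6} = x at *
  generalize vol A ![1, 1, 1, 1, 1, 1, 0, 1, 1, 1] {0, 6} = y at *
  field_simp at h5 ⊢
  linear_combination h5

/-- The measure of the forms reducing to a unit multiple of `X³`, in terms of the two kinds of
forms that a step of minimalisation leads to. -/
lemma vol_line (hA : IsInsolubleLocus A) :
    (1 - ((p : ℝ)⁻¹) ^ 18) * vol A ![0, 1, 1, 1, 1, 1, 1, 1, 1, 1] {0}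
      = (p + 1) * (((p : ℝ)⁻¹) ^ 10 * vol A ![1, 1, 1, 1, 1, 1, 0, 1, 1, 1] {0, 6}
        + vol A ![2, 2, 2, 1, 1, 1, 0, 1, 1, 1] {0, 6}) := by
  have hp : (p : ℝ) ≠ 0 := by exact_mod_cast (Fact.out : p.Prime).ne_zero
  have h1 : vol A ![0, 1, 1, 1, 1, 1, 1, 1, 1, 1] {0}
      = vol A ![2, 2, 2, 1, 1, 1, 0, 0, 0, 0] {0} := hA.vol_shiftX _ (by decide)
  have h2 := hA.vol_triple_root (a := 2) (b := 2) (g := 1) (by decide) (by decide) (by decide)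
  have h3 : vol A ![2, 2, 2, 1, 1, 1, 1, 1, 1, 1] {0}
      = ((p : ℝ)⁻¹) ^ 10 * vol A ![1, 1, 1, 0, 0, 0, 0, 0, 0, 0] {0} :=
    hA.vol_add_one _ (by decide)
  have h4 : vol A ![1, 1, 1, 0, 0, 0, 0, 0, 0, 0] {0}
      = vol A ![1, 1, 1, 1, 1, 1, 0, 0, 0, 0] {0} :=
    vol_restrict A (by decide) fun c hc hbox i => by
      obtain ⟨-, -, h3, h4, h5⟩ := hA.red_eq_zero_of_red_zero hc
        (red_eq_zero_of_mem_box hbox (i := 0) (by decide))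
      rw [red_eq_zero_iff] at h3 h4 h5
      have hi := (hbox i).1
      fin_cases i <;> first | (simp; done) | simpa using h3 | simpa using h4 | simpa using h5 |
        simpa using hi
  have h5 := hA.vol_triple_root (a := 1) (b := 1) (g := 1) (by decide) (by decide) (by decide)
  have h6 : vol A ![1, 1, 1, 1, 1, 1, 1, 1, 1, 1] {0} = ((p : ℝ)⁻¹) ^ 10 * vol A 0 {0} :=
    hA.vol_add_one _ (by decide)
  rw [h3, h4, h5, h6, hA.vol_zero_singleton, ← h1] at h2
  field_simp at h2 ⊢
  linear_combination h2

/-- The measure of any set of forms with the properties of the insoluble locus. -/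
theorem measure_eq (hA : IsInsolubleLocus A) : (cubicMeasure p).real A
    = (p : ℝ) ^ 11 * ((p : ℝ) - 1) * ((p : ℝ) ^ 2 - 1) * ((p : ℝ) ^ 3 - 1) /
      (((p : ℝ) ^ 8 - 1) * ((p : ℝ) ^ 9 - 1) * ((p : ℝ) ^ 10 - 1)) := by
  have hp1 : (1 : ℝ) < p := by exact_mod_cast (Fact.out : p.Prime).one_lt
  have hp : (p : ℝ) ≠ 0 := by positivity
  have hpow : ∀ n : ℕ, n ≠ 0 → (p : ℝ) ^ n - 1 ≠ 0 := fun n hn =>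
    (sub_pos.2 (one_lt_pow₀ hp1 hn)).ne'
  have h8 := hpow 8 (by decide)
  have h9 := hpow 9 (by decide)
  have h10 := hpow 10 (by decide)
  have h18 := hpow 18 (by decide)
  have huniv : (cubicMeasure p).real A = vol A 0 ∅ := by
    have : box p 0 ∅ = Set.univ := by ext c; simp [box]
    rw [vol, this, Set.inter_univ]
  have e0 := hA.vol_zero_empty
  rw [hA.vol_add_one (n := 0) (n' := 1) ∅ rfl] at e0
  have e1 := hA.vol_line
  have e2 := hA.vol_line_point
  have e3 := hA.vol_line_point_of_dvd
  rw [huniv]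
  generalize vol A 0 ∅ = a at *
  generalize vol A ![0, 1, 1, 1, 1, 1, 1, 1, 1, 1] {0} = b at *
  generalize vol A ![2, 2, 2, 1, 1, 1, 0, 1, 1, 1] {0, 6} = d at *
  generalize vol A ![1, 1, 1, 1, 1, 1, 0, 1, 1, 1] {0, 6} = e at *
  generalize (p : ℝ) = x at *
  have hd : d = x ^ 8 * (x - 1) ^ 3 / (x ^ 16 * (x ^ 8 - 1)) := by
    field_simp at e2 ⊢
    linear_combination e2
  have he : e = x * d := by
    have hne : 1 - x⁻¹ ^ 8 ≠ 0 := by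
      intro h
      apply h8
      field_simp at h
      linear_combination h
    refine mul_left_cancel₀ hne ?_
    rw [e3, ← e2]; ring
  have hb : b = (x + 1) * (x ^ 9 + 1) * x ^ 9 * d / (x ^ 18 - 1) := by
    rw [he] at e1
    rw [eq_div_iff h18]
    field_simp at e1 ⊢
    linear_combination e1
  have ha : a = x ^ 10 * (x ^ 2 + x + 1) * b / (x ^ 10 - 1) := by
    rw [eq_div_iff h10]
    field_simp at e0 ⊢
    linear_combination e0
  have h18' : x ^ 18 - 1 = (x ^ 9 - 1) * (x ^ 9 + 1) := by ring
  have h9' : x ^ 9 + 1 ≠ 0 := by positivity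
  rw [ha, hb, hd, h18']
  field_simp
  ring

end IsInsolubleLocus

end Measure

/-! ### The insoluble locus is null-measurable -/

section Locus

variable {p : ℕ} [Fact p.Prime]

/-- A form over `ℤ_p`, seen as a form over `ℚ_p`. -/
def toField (c : Fin 10 → ℤ_[p]) : Fin 10 → ℚ_[p] := algebraMap ℤ_[p] ℚ_[p] ∘ c

lemma hasPoint_toField_iff (c : Fin 10 → ℤ_[p]) :
    HasPoint (toField c) (maxUnramified p) ↔ HasPoint c (maxUnramified p) := by
  rw [hasPoint_iff, hasPoint_iff]
  simp only [toField, Function.comp, ← IsScalarTower.algebraMap_apply]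

/-- Any stable property of insoluble forms that holds for the critical forms cuts out a set whose
measure is determined by `IsInsolubleLocus.measure_eq`. -/
lemma isInsolubleLocus_of_isStable {I : (Fin 10 → ℚ_[p]) → Prop} (hI : IsStable I)
    (hcrit : ∀ c, IsCritical c → I c) (hins : ∀ c, I c → ¬ HasPoint c (maxUnramified p)) :
    IsInsolubleLocus {c : Fin 10 → ℤ_[p] | I (toField c)} where
  swapXY c := by
    simp only [Set.mem_ofPred_eq, toField, map_swapXY]
    exact ⟨fun h => by simpa only [swapXY_swapXY] using hI.swapXY h, hI.swapXY⟩
  swapYZ c := by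
    simp only [Set.mem_ofPred_eq, toField, map_swapYZ]
    exact ⟨fun h => by simpa only [swapYZ_swapYZ] using hI.swapYZ h, hI.swapYZ⟩
  shearX u v c := by
    simp only [Set.mem_ofPred_eq, toField, map_shearX]
    refine ⟨fun h => ?_, hI.shearX _ _⟩
    simpa only [shearX_neg_shearX] using
      hI.shearX (-algebraMap ℤ_[p] ℚ_[p] u) (-algebraMap ℤ_[p] ℚ_[p] v) h
  shearY u c := by
    simp only [Set.mem_ofPred_eq, toField, map_shearY]
    refine ⟨fun h => ?_, hI.shearY _⟩
    simpa only [shearY_neg_shearY] using hI.shearY (-algebraMap ℤ_[p] ℚ_[p] u) h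
  scaleX c := by
    have hp : algebraMap ℤ_[p] ℚ_[p] p ≠ 0 := by
      rw [map_natCast]; exact_mod_cast (Fact.out : p.Prime).ne_zero
    simp only [Set.mem_ofPred_eq, toField, map_scaleX]
    refine ⟨fun h => ?_, hI.scaleX hp⟩
    simpa only [scaleX_scaleX, inv_mul_cancel₀ hp, scaleX_one] using hI.scaleX (inv_ne_zero hp) h
  smul c := by
    have hp : algebraMap ℤ_[p] ℚ_[p] p ≠ 0 := by
      rw [map_natCast]; exact_mod_cast (Fact.out : p.Prime).ne_zero
    simp only [Set.mem_ofPred_eq, toField, map_smul_coeff]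
    refine ⟨fun h => ?_, hI.smul hp⟩
    simpa only [inv_smul_smul₀ hp] using hI.smul (inv_ne_zero hp) h
  reduction c hc := by
    have h := hins _ hc
    rw [hasPoint_toField_iff] at h
    by_contra! h'
    exact h (hasPoint_of_reduction c h'.1 h'.2)
  critical c hc := by
    refine hcrit _ fun i => ?_
    have hnorm : ‖toField c i‖ = ‖c i‖ := rfl
    have hi := hc i
    rw [prime_pow_dvd_iff, prime_pow_dvd_iff] at hi
    rw [hnorm]
    refine ⟨hi.1, fun hiU => le_antisymm hi.1 ?_⟩
    have h := hi.2 hiU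
    have hz : ∀ n : ℕ, ((p : ℝ)⁻¹) ^ n = (p : ℝ) ^ (-(n : ℤ)) := fun n => by
      rw [zpow_neg, zpow_natCast, inv_pow]
    rw [hz] at h ⊢
    by_contra! hlt
    apply h
    have he : -((critVal i + 1 : ℕ) : ℤ) + 1 = -(critVal i : ℤ) := by push_cast; ring
    rwa [PadicInt.norm_le_pow_iff_norm_lt_pow_add_one, he]

lemma isInsolubleLocus_not_hasPoint :
    IsInsolubleLocus {c : Fin 10 → ℤ_[p] | ¬ HasPoint c (maxUnramified p)} := by
  have := isInsolubleLocus_of_isStable (p := p) isStable_not_hasPoint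
    (fun _ => not_hasPoint_of_isCritical) (fun _ => id)
  simpa only [hasPoint_toField_iff] using this

/-- The insoluble locus contains the open set of saturated forms, which has the same measure. -/
lemma nullMeasurableSet_not_hasPoint :
    NullMeasurableSet {c : Fin 10 → ℤ_[p] | ¬ HasPoint c (maxUnramified p)} (cubicMeasure p) := by
  have hle : ∀ c : Fin 10 → ℚ_[p], Saturated c → ¬ HasPoint c (maxUnramified p) := fun c =>
    Saturated.of_isStable isStable_not_hasPoint fun _ => not_hasPoint_of_isCritical
  have hS := isInsolubleLocus_of_isStable (p := p) isStable_saturated Saturated.critical hle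
  have hopen : IsOpen {c : Fin 10 → ℤ_[p] | Saturated (toField c)} := by
    refine isOpen_saturated.preimage (continuous_pi fun i => ?_)
    exact continuous_subtype_val.comp (continuous_apply i)
  have hsub : {c : Fin 10 → ℤ_[p] | Saturated (toField c)}
      ⊆ {c | ¬ HasPoint c (maxUnramified p)} := fun c hc => by
    have := hle _ hc
    rwa [hasPoint_toField_iff] at this
  have hmeas := hS.measure_eq.trans isInsolubleLocus_not_hasPoint.measure_eq.symm
  rw [measureReal_eq_measureReal_iff] at hmeas
  exact hopen.measurableSet.nullMeasurableSet.congr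
    (ae_eq_of_subset_of_measure_ge hsub hmeas.ge hopen.measurableSet.nullMeasurableSet
      (measure_ne_top _ _))

end Locus

end PlaneCubic

end

theorem theorem4p1 (p : ℕ) [Fact p.Prime] :
    MeasureTheory.NullMeasurableSet
        {c : Fin 10 → ℤ_[p] | PlaneCubic.HasPoint c (PlaneCubic.maxUnramified p)}
        (PlaneCubic.cubicMeasure p) ∧
      (PlaneCubic.cubicMeasure p).real
          {c : Fin 10 → ℤ_[p] | PlaneCubic.HasPoint c (PlaneCubic.maxUnramified p)} =
        1 - (p : ℝ) ^ 11 * ((p : ℝ) - 1) * ((p : ℝ) ^ 2 - 1) * ((p : ℝ) ^ 3 - 1) /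
          (((p : ℝ) ^ 8 - 1) * ((p : ℝ) ^ 9 - 1) * ((p : ℝ) ^ 10 - 1)) := by
  have hnull := (PlaneCubic.nullMeasurableSet_not_hasPoint (p := p)).compl
  have hcompl : {c : Fin 10 → ℤ_[p] | ¬ PlaneCubic.HasPoint c (PlaneCubic.maxUnramified p)}ᶜ
      = {c | PlaneCubic.HasPoint c (PlaneCubic.maxUnramified p)} := by
    ext c; simp
  rw [← PlaneCubic.isInsolubleLocus_not_hasPoint.measure_eq, ← hcompl]
  exact ⟨hnull, by
    rw [measureReal_compl₀ PlaneCubic.nullMeasurableSet_not_hasPoint, probReal_univ]⟩
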